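/- Let $F$ be a $p$-adic field of characteristic $0$ with ring of integers $\mathcal R$, maximal ideal $\mathfrak p$, uniformizer $\pi$, valuation $\mathrm{val}$ (with $\mathrm{val}(\pi)=1$, $\mathrm{val}(0)=\infty$), residual characteristic $p>2$ and residue field of cardinality $q>3$. Let $K=\mathrm{GL}(3,\mathcal R)$. For a character $\psi$ of $F^\times$ let $\mathrm{cond}(\psi)$ be the least $m\ge 0$ such that $\psi$ is trivial on $(1+\mathfrak p^m)\cap\mathcal R^\times$. Let $\chi_2,\chi_3$ be characters of $F^\times$ with $\mathrm{cond}(\chi_2)=M\le N=\mathrm{cond}(\chi_3)=\mathrm{cond}(\chi_2\chi_3^{-1})$ and $N>0$. Order triples entrywise by $\preceq$. Let $\mathcal T_m$ be the set of $c=(c_1,c_2,c_3)\in\mathbb Z^3$ with $0\le c_1,c_2\le c_3\le c_1+c_2$ and $(M,N,N)\preceq c$. For $c\in\mathcal T_m$ let $C_c$ be the subgroup of all $g\in K$ with $g_{21}\in\mathfrak p^{c_1}$, $g_{32}\in\mathfrak p^{c_2}$, $g_{31}\in\mathfrak p^{c_3}$, let $\chi_c(g)=\chi_2(g_{22})\chi_3(g_{33})$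 for $g\in C_c$ (where the factor $\chi_2(g_{22})$ is understood to be $1$ if $g_{22}$ is not a unit, which can happen only if $c_1=M=0$), and let $U_c=\mathrm{Ind}_{C_c}^K\chi_c$. For $c,d\in\mathcal T_m$ the intertwining operators between $U_c$ and $U_d$ are described by the space $\mathcal H(\chi_c,\chi_d)$ of functions $f:K\to\mathbb C$ with $f(gkg')=\chi_c(g)f(k)\chi_d(g')$ for all $g\in C_c$, $k\in K$, $g'\in C_d$. The double coset $C_ckC_d$ is said to support an intertwining operator if some $f\in\mathcal H(\chi_c,\chi_d)$ has $f(k)\neq0$. Put $$t_{a,x}=\begin{bmatrix}1&0&0\\ \pi^{a_1}&1&0\\ x\pi^{a_3}&\pi^{a_2}&1\end{bmatrix},\quad s_1^{(\alpha,\beta)}=\begin{bmatrix}0&1&0\\1&0&0\\ \pi^\beta&\pi^\alpha&1\end{bmatrix},\quad s_2^{(\alpha,\beta)}=\begin{bmatrix}1&0&0\\ \pi^\beta&0&1\\ \pi^\alpha&1&0\end{bmatrix},$$ $$s_1s_2^{(\alpha)}=\begin{bmatrix}0&0&1\\1&0&0\\ \pi^\alpha&1&0\end{bmatrix},\quad s_2s_1^{(\alpha)}=\begin{bmatrix}0&1&0\\0&\pi^\alpha&1\\1&0&0\end{bmatrix},\quad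 w_0=\begin{bmatrix}0&0&1\\0&1&0\\1&0&0\end{bmatrix}.$$ Let $\mathcal T^1$ be the set of $a\in\mathbb Z^3$ with $1\le a_1,a_2\le a_3$. For $c,d\in\mathcal T_m$ write $\underline c_i=\max\{c_i,1\}$, and let $\mathcal T_{c,d}$ be the set of $a\in\mathcal T^1$ with $a\preceq\underline c$, $a\preceq\underline d$ and $a_3\le\min\{a_1+\underline c_2,\underline d_1+a_2\}$, except that $\mathcal T_{c,d}=\{(1,n,n): 1\le n\le\min\{c_2,d_2\}\}$ if $c_1=d_1=0$. Let $R_{c,d}$ be the set of the following elements of $K$: * type $1$: $t_{a,x}$ with $a\in\mathcal T_{c,d}$, $x\in\mathcal R^\times$; * type $s_1$ (only if $c_1d_1>0$): $s_1^{(\alpha,\beta)}$ with $1\le\alpha\le\min\{\underline d_2,c_3\}$, $1\le\beta\le\min\{\underline c_2,d_3\}$, $-c_1\le\beta-\alpha\le d_1$; * type $s_2$ (only if $c_1+d_1>0$): $s_2^{(\alpha,\beta)}$ with $1\le\alpha\le\min\{\underline d_1,c_3\}$, $1\le\beta\le\min\{\underline c_1,d_3\}$, $-c_2\le\beta-\alpha\le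 d_2$; * type $s_1s_2$ (only if $c_1d_1>0$): $s_1s_2^{(\alpha)}$ with $1\le\alpha\le\min\{d_1,c_2\}$; * type $s_2s_1$ (only if $c_1d_1>0$): $s_2s_1^{(\alpha)}$ with $1\le\alpha\le\min\{c_1,d_2\}$; * type $w_0$: $w_0$. For $w\in\{1,s_1,s_2,s_1s_2,s_2s_1,w_0\}$ let $S^w_{c,d}$ be the set of those $k\in R_{c,d}$ of type $w$ for which $C_ckC_d$ supports an intertwining operator, let $S_{c,d}=\bigcup_wS^w_{c,d}$, $S^w=\bigcup_{c,d\in\mathcal T_m}S^w_{c,d}$ and $S=\bigcup_wS^w$. **Theorem.** For all $c,d\in\mathcal T_m$, the double cosets in $C_c\backslash K/C_d$ that support an intertwining operator are exactly the $C_csC_d$ with $s\in S_{c,d}$. Each element of $S$ lies in $S_{c,c}$ for some $c\in\mathcal T_m$, so that $S$ represents the double cosets that support self-intertwining operators of some $U_c$, $c\in\mathcal T_m$. Moreover: 1. $S^1$ is the set of all $t_{a,x}$ with $a\in\mathcal T^1$, $a_3\ge\max\{a_1,a_2\}\ge N$ and $x\in\mathcal R^\times$, excluding only the $t_{a,1}$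 for which $a_1+a_2=a_3$ and ($a_1<M$ or $a_2<N$); 2. $S^{s_1}=\{s_1^{(\alpha,\beta)}:\alpha,\beta\ge N\}$; 3. $S^{s_2}=\{s_2^{(\alpha,\beta)}:\alpha,\beta\ge N\}$; 4. $S^{s_1s_2}=S^{s_2s_1}=S^{w_0}=\emptyset$. Finally, these double cosets are distinct up to the natural identification of the parameters $x$: for all $s,s'\in S$ and all sufficiently large $c,d\in\mathcal T_m$ (depending on $s,s'$), $C_csC_d=C_cs'C_d$ if and only if either $s=s'$, or $s=t_{a,x}$ and $s'=t_{a,y}$ for some $a,x,y$ such that $x$ and $y$ have the same image in the parameter set $X^a_{c,d}$ for all sufficiently large $c,d\in\mathcal T_m$. Here $x$ and $y$ have the same image in $X^a_{c,d}$ when $\mathrm{val}(x-y)\ge a(c,d)$, if $a_1+a_2\ne a_3$, and when $\mathrm{val}(x-y)\ge\min\{\mathrm{val}(x-1)+a(c,d),\,a(c,d)'\}$, if $a_1+a_2=a_3$, where $$a(c,d)=\max\{0,\min\{a_1,a_2,a_3-a_1,a_3-a_2,c_i-a_i,d_i-a_i\ (i=1,2,3),a_1+c_2-a_3,d_1+a_2-a_3\}\},$$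 $$a(c,d)'=\max\{0,\min\{d_3-a_3,c_3-a_3,c_1-a_1,d_2-a_2\}\}.$$ -/

import Mathlib

open scoped ValuativeRel

namespace PSeries

/-- A triple `(c₁, c₂, c₃)` of natural numbers; `c 0, c 1, c 2` are the entries `c₁, c₂, c₃`.
The pointwise order on functions is the partial order `⪯`. -/
abbrev Triple := Fin 3 → ℕ

/-- The poset `𝒯`: triples with `0 ≤ c₁, c₂ ≤ c₃ ≤ c₁ + c₂`. -/
def T : Set Triple := {c | c 0 ≤ c 2 ∧ c 1 ≤ c 2 ∧ c 2 ≤ c 0 + c 1}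

/-- The triple `m = (M, N, N)`. -/
def mTriple (M N : ℕ) : Triple := ![M, N, N]

/-- The subposet `𝒯_m` of all `c ∈ 𝒯` with `m ⪯ c`. -/
def Tm (M N : ℕ) : Set Triple := {c | c ∈ T ∧ mTriple M N ≤ c}

/-- The set `𝒯¹`: triples with `1 ≤ a₁, a₂ ≤ a₃`. -/
def T1 : Set Triple := {a | 1 ≤ a 0 ∧ 1 ≤ a 1 ∧ a 0 ≤ a 2 ∧ a 1 ≤ a 2}

/-- The triple with entries `max (cᵢ, 1)`. -/
def under (c : Triple) : Triple := fun i => max (c i) 1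

/-- The index set `𝒯_{c,d}`: a general formula with three exceptional cases. -/
def Tcd (c d : Triple) : Set Triple :=
  {a | if c = 0 ∨ d = 0 then a = ![1, 1, 1]
    else if 0 < c 1 * d 1 ∧ c 0 = 0 ∧ d 0 = 0 then
      ∃ n, 1 ≤ n ∧ n ≤ min (c 1) (d 1) ∧ a = ![1, n, n]
    else if 0 < c 0 * d 0 ∧ c 1 = 0 ∧ d 1 = 0 then
      ∃ n, 1 ≤ n ∧ n ≤ min (c 0) (d 0) ∧ a = ![n, 1, n]
    else a ∈ T1 ∧ a ≤ under c ∧ a ≤ under d ∧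
      a 2 ≤ min (a 0 + under c 1) (under d 0 + a 1)}

/-- The minimum of the three entries of a triple of integers. -/
def minEntry (z : Fin 3 → ℤ) : ℤ := min (z 0) (min (z 1) (z 2))

/-- The difference of two triples, as a triple of integers. -/
def diff (c a : Triple) : Fin 3 → ℤ := fun i => (c i : ℤ) - (a i : ℤ)

/-- The number `a(c,d) = max {0, min {a₁, a₂, a₃-a₁, a₃-a₂, c-a, d-a, a₁+c₂-a₃, d₁+a₂-a₃}}`,
where `c-a` and `d-a` stand for all their entries. -/
def acd (c d a : Triple) : ℕ :=
  (max 0 (min (a 0 : ℤ) (min (a 1 : ℤ) (min ((a 2 : ℤ) - a 0) (min ((a 2 : ℤ) - a 1)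
    (min (minEntry (diff c a)) (min (minEntry (diff d a))
      (min ((a 0 : ℤ) + c 1 - a 2) ((d 0 : ℤ) + a 1 - a 2))))))))).toNat

/-- The number `a(c,d)' = max {0, min {d₃-a₃, c₃-a₃, c₁-a₁, d₂-a₂}}`. -/
def acd' (c d a : Triple) : ℕ :=
  (max 0 (min ((d 2 : ℤ) - a 2) (min ((c 2 : ℤ) - a 2)
    (min ((c 0 : ℤ) - a 0) ((d 1 : ℤ) - a 1))))).toNat

/-- Names `1, s₁, s₂, s₁s₂, s₂s₁, w₀` of the six elements of the Weyl group `W ≃ S₃`. -/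
inductive Weyl where
  | one | s1 | s2 | s1s2 | s2s1 | w0

/-- The subset `W_{c,d}` of the Weyl group. -/
def Wcd (c d : Triple) : Set Weyl :=
  {w | if (∀ i, 1 ≤ c i) ∧ (∀ i, 1 ≤ d i) then True
    else if 0 < c 0 * d 0 * (c 1 + d 1) ∧ c 1 * d 1 = 0 then
      w = Weyl.one ∨ w = Weyl.s1 ∨ w = Weyl.w0
    else if c 0 * d 0 = 0 ∧ 0 < (c 0 + d 0) * (c 1 * d 1) then
      w = Weyl.one ∨ w = Weyl.s2 ∨ w = Weyl.w0
    else if c 0 * c 1 = 0 ∧ d 0 * d 1 = 0 ∧ 0 < (c 0 + c 1) * (d 0 + d 1) then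
      w = Weyl.one ∨ w = Weyl.w0
    else w = Weyl.one}

section Representatives

variable {R : Type*} [CommRing R]

/-- The matrix `t_{a,x}`. -/
noncomputable def tMat (π : R) (a : Triple) (x : R) : GL (Fin 3) R :=
  Matrix.GeneralLinearGroup.mk''
    !![1, 0, 0; π ^ a 0, 1, 0; x * π ^ a 2, π ^ a 1, 1]
    (by simp [Matrix.det_fin_three])

/-- The matrix `s₁^{(α,β)}`. -/
noncomputable def s1Mat (π : R) (α β : ℕ) : GL (Fin 3) R :=
  Matrix.GeneralLinearGroup.mk''
    !![0, 1, 0; 1, 0, 0; π ^ β, π ^ α, 1]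
    (by simp [Matrix.det_fin_three])

/-- The matrix `s₂^{(α,β)}`. -/
noncomputable def s2Mat (π : R) (α β : ℕ) : GL (Fin 3) R :=
  Matrix.GeneralLinearGroup.mk''
    !![1, 0, 0; π ^ β, 0, 1; π ^ α, 1, 0]
    (by simp [Matrix.det_fin_three])

/-- The matrix `s₁s₂^{(α)}`. -/
noncomputable def s1s2Mat (π : R) (α : ℕ) : GL (Fin 3) R :=
  Matrix.GeneralLinearGroup.mk''
    !![0, 0, 1; 1, 0, 0; π ^ α, 1, 0]
    (by simp [Matrix.det_fin_three])

/-- The matrix `s₂s₁^{(α)}`. -/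
noncomputable def s2s1Mat (π : R) (α : ℕ) : GL (Fin 3) R :=
  Matrix.GeneralLinearGroup.mk''
    !![0, 1, 0; 0, π ^ α, 1; 1, 0, 0]
    (by simp [Matrix.det_fin_three])

/-- The matrix `w₀`. -/
noncomputable def w0Mat : GL (Fin 3) R :=
  Matrix.GeneralLinearGroup.mk''
    !![0, 0, 1; 0, 1, 0; 1, 0, 0]
    (by simp [Matrix.det_fin_three])

/-- The set `R_{c,d}^w` of distinguished double coset representatives of type `w`. For `w = 1`
all the units `x` are listed; two of them with the same image in `X^a_{c,d}` (see `SameX`) stand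
for the same representative. -/
def Rcd (π : R) (c d : Triple) : Weyl → Set (GL (Fin 3) R)
  | .one => {k | ∃ a ∈ Tcd c d, ∃ x : Rˣ, k = tMat π a x}
  | .s1 => {k | ∃ α β : ℕ, 1 ≤ α ∧ α ≤ min (under d 1) (c 2) ∧
      1 ≤ β ∧ β ≤ min (under c 1) (d 2) ∧
      -(c 0 : ℤ) ≤ (β : ℤ) - α ∧ (β : ℤ) - α ≤ d 0 ∧ k = s1Mat π α β}
  | .s2 => {k | ∃ α β : ℕ, 1 ≤ α ∧ α ≤ min (under d 0) (c 2) ∧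
      1 ≤ β ∧ β ≤ min (under c 0) (d 2) ∧
      -(c 1 : ℤ) ≤ (β : ℤ) - α ∧ (β : ℤ) - α ≤ d 1 ∧ k = s2Mat π α β}
  | .s1s2 => {k | ∃ α : ℕ, 1 ≤ α ∧ α ≤ min (d 0) (c 1) ∧ k = s1s2Mat π α}
  | .s2s1 => {k | ∃ α : ℕ, 1 ≤ α ∧ α ≤ min (c 0) (d 1) ∧ k = s2s1Mat π α}
  | .w0 => {w0Mat}

/-- `x` and `y` have the same image in the parameter set `X^a_{c,d}`. If `a₁ + a₂ ≠ a₃` this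
is congruence modulo `𝔭^{a(c,d)}`; if `a₁ + a₂ = a₃` and `val (x - 1) = i`, it means
`val (x - y) ≥ min {i + a(c,d), a(c,d)'}`. Here `val = emultiplicity π`, with `val 0 = ⊤`. -/
def SameX (π : R) (c d a : Triple) (x y : R) : Prop :=
  if a 0 + a 1 = a 2 then
    min (emultiplicity π (x - 1) + (acd c d a : ℕ∞)) (acd' c d a : ℕ∞) ≤ emultiplicity π (x - y)
  else (acd c d a : ℕ∞) ≤ emultiplicity π (x - y)

/-- `x` and `y` have the same image in `X^a_{c,d}` for all sufficiently large `c, d ∈ 𝒯_m`. -/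
def SameXLarge (π : R) (M N : ℕ) (a : Triple) (x y : R) : Prop :=
  ∃ e ∈ Tm M N, ∀ c ∈ Tm M N, ∀ d ∈ Tm M N, e ≤ c → e ≤ d → SameX π c d a x y

/-- The identification of representatives: `t_{a,x}` is identified with `t_{a,y}` when `x` and
`y` have the same image in `X^a_{c,d}` for `c, d` sufficiently large, and nothing else is
identified. -/
def Identified (π : R) (M N : ℕ) (s s' : GL (Fin 3) R) : Prop :=
  s = s' ∨ ∃ a ∈ T1, ∃ x y : Rˣ,
    s = tMat π a x ∧ s' = tMat π a y ∧ SameXLarge π M N a x y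

end Representatives

section LocalField

variable {F : Type*} [Field F] [ValuativeRel F]

/-- The restriction of a character of `Fˣ` to the units of the ring of integers. -/
noncomputable def unitChar (χ : Fˣ →* ℂˣ) : 𝒪[F]ˣ →* ℂˣ := χ.comp (Units.map (algebraMap 𝒪[F] F : 𝒪[F] →* F))

/-- `m` is the conductor of `χ`: the least `m ≥ 0` such that `χ` is trivial on the units
congruent to `1` modulo `𝔭^m` (so on all the units, if `m = 0`). -/
def IsConductor (χ : Fˣ →* ℂˣ) (m : ℕ) : Prop :=
  IsLeast {n : ℕ | ∀ u : 𝒪[F]ˣ, (u : 𝒪[F]) - 1 ∈ 𝓂[F] ^ n → unitChar χ u = 1} m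

open Classical in
/-- `χ` on a unit of the ring of integers, and `1` on a non-unit. -/
noncomputable def extChar (χ : Fˣ →* ℂˣ) (r : 𝒪[F]) : ℂ :=
  if h : IsUnit r then (unitChar χ h.unit : ℂ) else 1

/-- The subgroup `C_c` of `K = GL(3, 𝒪)`, as a set: the matrices with `(2,1)`, `(3,2)`, `(3,1)`
entries in `𝔭^{c₁}`, `𝔭^{c₂}`, `𝔭^{c₃}`. -/
def C (c : Triple) : Set (GL (Fin 3) 𝒪[F]) :=
  {g | g.val 1 0 ∈ 𝓂[F] ^ c 0 ∧ g.val 2 1 ∈ 𝓂[F] ^ c 1 ∧ g.val 2 0 ∈ 𝓂[F] ^ c 2}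

/-- The character `χ_c (g) = χ₂ (g₂₂) χ₃ (g₃₃)` of `C_c`, for `c ∈ 𝒯_m`. The entry `g₃₃` is always
a unit, because `c₂, c₃ ≥ N ≥ 1`. The entry `g₂₂` is a unit unless `c₁ = 0`; in that case `M = 0`,
so that `χ₂` is trivial on units and the factor `χ₂ (g₂₂)` is understood to be `1`. -/
noncomputable def chi (χ₂ χ₃ : Fˣ →* ℂˣ) (g : GL (Fin 3) 𝒪[F]) : ℂ :=
  extChar χ₂ (g.val 1 1) * extChar χ₃ (g.val 2 2)

/-- The space `ℋ(χ_c, χ_d)` of functions on `K` that transform by `χ_c` under `C_c` on the left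
and by `χ_d` under `C_d` on the right; it describes the intertwining operators between the
induced representations `U_c` and `U_d`. -/
def H (χ₂ χ₃ : Fˣ →* ℂˣ) (c d : Triple) : Submodule ℂ (GL (Fin 3) 𝒪[F] → ℂ) where
  carrier := {f | ∀ g ∈ C c, ∀ g' ∈ C d, ∀ k,
    f (g * k * g') = chi χ₂ χ₃ g * f k * chi χ₂ χ₃ g'}
  add_mem' := by
    intro f₁ f₂ h₁ h₂ g hg g' hg' k
    simp only [Pi.add_apply, h₁ g hg g' hg' k, h₂ g hg g' hg' k]
    ring
  zero_mem' := by
    intro g hg g' hg' k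
    simp
  smul_mem' := by
    intro r f h g hg g' hg' k
    simp only [Pi.smul_apply, smul_eq_mul, h g hg g' hg' k]
    ring

/-- The double coset `C_c k C_d` supports an element of `ℋ(χ_c, χ_d)`. -/
def Supports (χ₂ χ₃ : Fˣ →* ℂˣ) (c d : Triple) (k : GL (Fin 3) 𝒪[F]) : Prop :=
  ∃ f ∈ H χ₂ χ₃ c d, f k ≠ 0

/-- The set `S_{c,d}^w`: representatives in `R_{c,d}^w` of the double cosets supporting elements
of `ℋ(χ_c, χ_d)`; it is empty for `w ∉ W_{c,d}`. -/
def Scd (π : 𝒪[F]) (χ₂ χ₃ : Fˣ →* ℂˣ) (c d : Triple) (w : Weyl) : Set (GL (Fin 3) 𝒪[F]) :=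
  {k | w ∈ Wcd c d ∧ k ∈ Rcd π c d w ∧ Supports χ₂ χ₃ c d k}

/-- The union `S^w` of all the `S_{c,d}^w` with `c, d ∈ 𝒯_m`. -/
def SW (π : 𝒪[F]) (χ₂ χ₃ : Fˣ →* ℂˣ) (M N : ℕ) (w : Weyl) : Set (GL (Fin 3) 𝒪[F]) :=
  ⋃ c ∈ Tm M N, ⋃ d ∈ Tm M N, Scd π χ₂ χ₃ c d w

/-- The double coset `C_c k C_d`. -/
def dcoset (c d : Triple) (k : GL (Fin 3) 𝒪[F]) : Set (GL (Fin 3) 𝒪[F]) :=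
  DoubleCoset.doubleCoset k (C c) (C d)

end LocalField

end PSeries

open PSeries

/-!
A double coset `C_c k C_d` supports an intertwining operator if and only if `χ_c (g) = χ_d (h)`
whenever `g ∈ C_c`, `h ∈ C_d` and `g k = k h` (`supports_iff`). All arguments are explicit
computations with such pairs `(g, h)`. For a representative `k` of one of the given shapes the
matrix `h = k⁻¹ g k` has entries that are polynomials in those of `g` and `k`, so it is enough to
work with equations `G A = B H` between matrices over the discrete valuation ring (`Rel`) and with
divisibility by powers of the uniformizer `π`.

*Exhaustion.* The upper triangular matrices lie in every `C_c`, so the Bruhat decomposition over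
the residue field lifts to one over the ring (`rel_bruhat`). In the cells of `w₀`, `s₁s₂` and `s₂s₁`
diagonal matrices already violate the support condition, since `χ₃` is not trivial on units. In the
other cells row and column operations lead to the distinguished representatives
(`exists_rel_s1Form`, `exists_rel_s2Form`, `exists_rel_tForm`). In the cell of `1` one takes a lower
unipotent matrix in the double coset for which the sum of the valuations of its entries is minimal;
the inequalities that define `𝒯_{c,d}` say that no operation lowers this sum. Here `p > 2` enters:
an element can be added to or subtracted from another one, and one of the two choices does not
raise the valuation. If `c₁` or `d₁` vanishes, the reduction is carried out for the triples
`max (c, 1)`, `max (d, 1)`, and the permutation matrices that `C_c` or `C_d` then contains remove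
the cells that do not occur (`exists_rel_mem_Rcd`).

*Support.* Upper triangular pairs `(g, h)` give the necessary conditions on the exponents, for all
`c` and `d` (`MatSupports.le_of_s1Form`, `MatSupports.le_of_s2Form`,
`MatSupports.le_max_of_tForm`). If `x π ^ a₃ = π ^ a₁ π ^ a₂`, there are more such pairs than
otherwise, which yields the exceptional condition (`MatSupports.le_of_tForm_one`). Conversely, for
`c = d = (n, n, n)` with `n` large, the equation `g k = k h` forces the congruences between diagonal
entries that make the characters agree (`matSupports_s1Form`, `matSupports_s2Form`,
`matSupports_tForm`, `matSupports_tForm_one`).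

*Distinctness.* For large `c` and `d`, an equation `g s = s' h` is an equation between upper
triangular matrices modulo a high power of `π`. It determines the cell and the exponents, and for
`s = t_{a,x}`, `s' = t_{a,y}` it leaves one congruence between `x` and `y`
(`exists_congr_of_rel_tForm`). This congruence is the stable form of the identification in
`X^a_{c,d}` (`sameXLarge_iff`), and it suffices for the existence of upper triangular `g` and `h`
(`rel_of_sameXLimit`).
-/

namespace PSeries

/-! ### Matrix shapes and double cosets -/

section Forms

variable {R : Type*} [CommRing R]

/-- The lower unipotent matrix with entries `y, z, w` at the places `(2,1)`, `(3,1)`, `(3,2)`;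
the `t_{a,x}` are of this form. -/
def tForm (y z w : R) : Matrix (Fin 3) (Fin 3) R := !![1, 0, 0; y, 1, 0; z, w, 1]

/-- The matrices of the shape of `s₁^{(α,β)}`. -/
def s1Form (z w : R) : Matrix (Fin 3) (Fin 3) R := !![0, 1, 0; 1, 0, 0; z, w, 1]

/-- The matrices of the shape of `s₂^{(α,β)}`. -/
def s2Form (y z : R) : Matrix (Fin 3) (Fin 3) R := !![1, 0, 0; y, 0, 1; z, 1, 0]

/-- The matrices of the shape of `s₁s₂^{(α)}`. -/
def s1s2Form (z : R) : Matrix (Fin 3) (Fin 3) R := !![0, 0, 1; 1, 0, 0; z, 1, 0]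

/-- The matrices of the shape of `s₂s₁^{(α)}`. -/
def s2s1Form (w : R) : Matrix (Fin 3) (Fin 3) R := !![0, 1, 0; 0, w, 1; 1, 0, 0]

/-- The matrix of `w₀`. -/
def w0Form : Matrix (Fin 3) (Fin 3) R := !![0, 0, 1; 0, 1, 0; 1, 0, 0]

/-- The divisibility conditions that define `C_c`, on matrices. -/
def MemC (π : R) (c : Triple) (G : Matrix (Fin 3) (Fin 3) R) : Prop :=
  π ^ c 0 ∣ G 1 0 ∧ π ^ c 1 ∣ G 2 1 ∧ π ^ c 2 ∣ G 2 0

/-- `A` and `B` lie in the same `(C_c, C_d)` double coset, written without inverses so that it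
makes sense for matrices. -/
def Rel (π : R) (c d : Triple) (A B : Matrix (Fin 3) (Fin 3) R) : Prop :=
  ∃ G H : Matrix (Fin 3) (Fin 3) R, IsUnit G.det ∧ IsUnit H.det ∧ MemC π c G ∧ MemC π d H ∧
    G * A = B * H

theorem mul_eq_mul_iff (G A B H : Matrix (Fin 3) (Fin 3) R) : G * A = B * H ↔
    ∀ i j, G i 0 * A 0 j + G i 1 * A 1 j + G i 2 * A 2 j =
      B i 0 * H 0 j + B i 1 * H 1 j + B i 2 * H 2 j := by
  simp only [← Matrix.ext_iff, Matrix.mul_apply, Fin.sum_univ_three]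

theorem memC_of (π : R) (c : Triple) {g₀₀ g₀₁ g₀₂ g₁₀ g₁₁ g₁₂ g₂₀ g₂₁ g₂₂ : R}
    (h₁ : π ^ c 0 ∣ g₁₀) (h₂ : π ^ c 1 ∣ g₂₁) (h₃ : π ^ c 2 ∣ g₂₀) :
    MemC π c !![g₀₀, g₀₁, g₀₂; g₁₀, g₁₁, g₁₂; g₂₀, g₂₁, g₂₂] :=
  ⟨by simpa using h₁, by simpa using h₂, by simpa using h₃⟩

theorem MemC.mul {π : R} {c : Triple} (hc : c ∈ T) {G H : Matrix (Fin 3) (Fin 3) R}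
    (hG : MemC π c G) (hH : MemC π c H) : MemC π c (G * H) := by
  obtain ⟨h02, h12, h2⟩ := hc
  obtain ⟨g1, g2, g3⟩ := hG
  obtain ⟨k1, k2, k3⟩ := hH
  simp only [MemC, Matrix.mul_apply, Fin.sum_univ_three]
  refine ⟨dvd_add (dvd_add (g1.mul_right _) (k1.mul_left _))
      (((pow_dvd_pow π h02).trans k3).mul_left _),
    dvd_add (dvd_add (((pow_dvd_pow π h12).trans g3).mul_right _) (g2.mul_right _))
      (k2.mul_left _),
    dvd_add (dvd_add (g3.mul_right _) ((pow_dvd_pow π h2).trans ?_)) (k3.mul_left _)⟩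
  rw [pow_add, mul_comm (π ^ c 0)]
  exact mul_dvd_mul g2 k1

theorem MemC.mono {π : R} {c c' : Triple} (h : c ≤ c') {G : Matrix (Fin 3) (Fin 3) R}
    (hG : MemC π c' G) : MemC π c G :=
  ⟨(pow_dvd_pow π (h 0)).trans hG.1, (pow_dvd_pow π (h 1)).trans hG.2.1,
    (pow_dvd_pow π (h 2)).trans hG.2.2⟩

theorem Rel.mono {π : R} {c c' d d' : Triple} (hc : c ≤ c') (hd : d ≤ d')
    {A B : Matrix (Fin 3) (Fin 3) R} (h : Rel π c' d' A B) : Rel π c d A B := by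
  obtain ⟨G, H, h1, h2, h3, h4, h5⟩ := h
  exact ⟨G, H, h1, h2, h3.mono hc, h4.mono hd, h5⟩

theorem Rel.trans {π : R} {c d : Triple} (hc : c ∈ T) (hd : d ∈ T)
    {A B D : Matrix (Fin 3) (Fin 3) R} (h : Rel π c d A B) (h' : Rel π c d B D) :
    Rel π c d A D := by
  obtain ⟨G, H, h1, h2, h3, h4, h5⟩ := h
  obtain ⟨G', H', h1', h2', h3', h4', h5'⟩ := h'
  refine ⟨G' * G, H' * H, ?_, ?_, h3'.mul hc h3, h4'.mul hd h4, ?_⟩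
  · rw [Matrix.det_mul]; exact h1'.mul h1
  · rw [Matrix.det_mul]; exact h2'.mul h2
  · rw [Matrix.mul_assoc, h5, ← Matrix.mul_assoc, h5', Matrix.mul_assoc]

theorem Rel.isUnit_det {π : R} {c d : Triple} {A B : Matrix (Fin 3) (Fin 3) R}
    (h : Rel π c d A B) (hA : IsUnit A.det) : IsUnit B.det := by
  obtain ⟨G, H, h1, h2, -, -, h5⟩ := h
  have := congrArg Matrix.det h5
  rw [Matrix.det_mul, Matrix.det_mul] at this
  exact isUnit_of_mul_isUnit_left (this ▸ h1.mul hA)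

/-! ### Elementary operations -/

/-- Row and column operations by lower unipotent matrices. -/
theorem rel_tForm_lower {π : R} {c d : Triple} {y z w y' z' w' p r q p' r' q' : R}
    (hp : π ^ c 0 ∣ p) (hq : π ^ c 1 ∣ q) (hr : π ^ c 2 ∣ r)
    (hp' : π ^ d 0 ∣ p') (hq' : π ^ d 1 ∣ q') (hr' : π ^ d 2 ∣ r')
    (h₁ : p + y = y' + p') (h₂ : q + w = w' + q') (h₃ : r + q * y + z = z' + w' * p' + r') :
    Rel π c d (tForm y z w) (tForm y' z' w') := by
  refine ⟨tForm p r q, tForm p' r' q', by simp [tForm, Matrix.det_fin_three],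
    by simp [tForm, Matrix.det_fin_three], memC_of π c hp hq hr, memC_of π d hp' hq' hr', ?_⟩
  rw [mul_eq_mul_iff]
  intro i j
  fin_cases i <;> fin_cases j <;> simp [tForm] <;> grind

/-- Scaling by diagonal matrices. -/
theorem rel_tForm_diag {π : R} {c d : Triple} (y z w : R) (u v : Rˣ) :
    Rel π c d (tForm y z w) (tForm (u * y) (u * v * z) (v * w)) := by
  refine ⟨!![1, 0, 0; 0, u, 0; 0, 0, u * v], !![1, 0, 0; 0, u, 0; 0, 0, u * v],
    by simp [Matrix.det_fin_three], by simp [Matrix.det_fin_three],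
    memC_of π c (dvd_zero _) (dvd_zero _) (dvd_zero _),
    memC_of π d (dvd_zero _) (dvd_zero _) (dvd_zero _), ?_⟩
  rw [mul_eq_mul_iff]
  intro i j
  fin_cases i <;> fin_cases j <;> simp [tForm]
  ring

/-- Adding the third row to the second one, and clearing the last column. -/
theorem rel_tForm_add_left {π : R} {c d : Triple} (y z w : R) (s : Rˣ) (hs : (s : R) = 1 + w) :
    Rel π c d (tForm y z w) (tForm (s⁻¹ * (y + z)) (s * z) (s * w)) := by
  have hs' : (s : R) * (s⁻¹ : Rˣ) = 1 := by simp
  refine ⟨!![1, 0, 0; 0, (s⁻¹ : Rˣ), (s⁻¹ : Rˣ); 0, 0, s], !![1, 0, 0; 0, 1, (s⁻¹ : Rˣ); 0, 0, 1],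
    by simp [Matrix.det_fin_three], by simp [Matrix.det_fin_three],
    memC_of π c (dvd_zero _) (dvd_zero _) (dvd_zero _),
    memC_of π d (dvd_zero _) (dvd_zero _) (dvd_zero _), ?_⟩
  rw [mul_eq_mul_iff]
  generalize (((s⁻¹ : Rˣ)) : R) = t at hs' ⊢
  intro i j
  fin_cases i <;> fin_cases j <;> simp [tForm] <;> grind

/-- Adding the first column to the second one, and clearing the first row. -/
theorem rel_tForm_add_right {π : R} {c d : Triple} (y z w : R) (s : Rˣ) (hs : (s : R) = 1 + y) :
    Rel π c d (tForm y z w) (tForm (s * y) (s * z) (s⁻¹ * (w + z))) := by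
  have hs' : (s : R) * (s⁻¹ : Rˣ) = 1 := by simp
  refine ⟨!![1, -(s⁻¹ : Rˣ), 0; 0, 1, 0; 0, 0, 1], !![(s⁻¹ : Rˣ), -(s⁻¹ : Rˣ), 0; 0, s, 0; 0, 0, 1],
    by simp [Matrix.det_fin_three], by simp [Matrix.det_fin_three],
    memC_of π c (dvd_zero _) (dvd_zero _) (dvd_zero _),
    memC_of π d (dvd_zero _) (dvd_zero _) (dvd_zero _), ?_⟩
  rw [mul_eq_mul_iff]
  generalize (((s⁻¹ : Rˣ)) : R) = t at hs' ⊢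
  intro i j
  fin_cases i <;> fin_cases j <;> simp [tForm] <;> grind

/-- The row operation with entry `p` at `(2,1)` on a matrix of shape `s₁`, followed by changes of
`z`, `w` by elements of the ideals that `C_c` and `C_d` provide. On the right it is undone by an
upper triangular matrix. -/
theorem rel_s1Form_left {π : R} {c d : Triple} {z w z' w' p q r q' r' : R}
    (hp : π ^ c 0 ∣ p) (hq : π ^ c 1 ∣ q) (hr : π ^ c 2 ∣ r) (hq' : π ^ d 1 ∣ q')
    (hr' : π ^ d 2 ∣ r') (h₁ : z + q = z' + r') (h₂ : w + r = z' * p + w' + q') :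
    Rel π c d (s1Form z w) (s1Form z' w') := by
  refine ⟨!![1, 0, 0; p, 1, 0; r, q, 1], !![1, p, 0; 0, 1, 0; r', q', 1],
    by simp [Matrix.det_fin_three], by simp [Matrix.det_fin_three],
    memC_of π c hp hq hr, memC_of π d (dvd_zero _) hq' hr', ?_⟩
  rw [mul_eq_mul_iff]
  intro i j
  fin_cases i <;> fin_cases j <;> simp [s1Form] <;> grind

/-- The column counterpart of `rel_s1Form_left`: the entry `p` at `(2,1)` stands on the right. -/
theorem rel_s1Form_right {π : R} {c d : Triple} {z w z' w' p q r q' r' : R}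
    (hp : π ^ d 0 ∣ p) (hq : π ^ c 1 ∣ q) (hr : π ^ c 2 ∣ r) (hq' : π ^ d 1 ∣ q')
    (hr' : π ^ d 2 ∣ r') (h₁ : z + q = z' + w' * p + r') (h₂ : w + r = w' + q') :
    Rel π c d (s1Form z w) (s1Form z' w') := by
  refine ⟨!![1, p, 0; 0, 1, 0; r, q, 1], !![1, 0, 0; p, 1, 0; r', q', 1],
    by simp [Matrix.det_fin_three], by simp [Matrix.det_fin_three],
    memC_of π c (dvd_zero _) hq hr, memC_of π d hp hq' hr', ?_⟩
  rw [mul_eq_mul_iff]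
  intro i j
  fin_cases i <;> fin_cases j <;> simp [s1Form] <;> grind

theorem rel_s1Form_diag {π : R} {c d : Triple} (z w : R) (u v : Rˣ) :
    Rel π c d (s1Form z w) (s1Form (u * z) (v * w)) := by
  have hu : (u : R) * (u⁻¹ : Rˣ) = 1 := by simp
  have hv : (v : R) * (v⁻¹ : Rˣ) = 1 := by simp
  refine ⟨!![(v⁻¹ : Rˣ), 0, 0; 0, (u⁻¹ : Rˣ), 0; 0, 0, 1],
    !![(u⁻¹ : Rˣ), 0, 0; 0, (v⁻¹ : Rˣ), 0; 0, 0, 1],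
    by simp [Matrix.det_fin_three], by simp [Matrix.det_fin_three],
    memC_of π c (dvd_zero _) (dvd_zero _) (dvd_zero _),
    memC_of π d (dvd_zero _) (dvd_zero _) (dvd_zero _), ?_⟩
  rw [mul_eq_mul_iff]
  generalize (((u⁻¹ : Rˣ)) : R) = u' at hu ⊢
  generalize (((v⁻¹ : Rˣ)) : R) = v' at hv ⊢
  intro i j
  fin_cases i <;> fin_cases j <;> simp [s1Form] <;> grind

/-- The row operation with entry `q` at `(3,2)` on a matrix of shape `s₂`, followed by changes of
`y`, `z` by elements of the ideals that `C_c` and `C_d` provide. -/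
theorem rel_s2Form_left {π : R} {c d : Triple} {y z y' z' p q r p' r' : R}
    (hp : π ^ c 0 ∣ p) (hq : π ^ c 1 ∣ q) (hr : π ^ c 2 ∣ r) (hp' : π ^ d 0 ∣ p')
    (hr' : π ^ d 2 ∣ r') (h₁ : y + p = y' + r') (h₂ : z + q * y + r = z' + p') :
    Rel π c d (s2Form y z) (s2Form y' z') := by
  refine ⟨!![1, 0, 0; p, 1, 0; r, q, 1], !![1, 0, 0; p', 1, q; r', 0, 1],
    by simp [Matrix.det_fin_three], by simp [Matrix.det_fin_three],
    memC_of π c hp hq hr, memC_of π d hp' (dvd_zero _) hr', ?_⟩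
  rw [mul_eq_mul_iff]
  intro i j
  fin_cases i <;> fin_cases j <;> simp [s2Form] <;> grind

/-- The column counterpart of `rel_s2Form_left`: the entry `q` at `(3,2)` stands on the right. -/
theorem rel_s2Form_right {π : R} {c d : Triple} {y z y' z' p q r p' r' : R}
    (hp : π ^ c 0 ∣ p) (hq : π ^ d 1 ∣ q) (hr : π ^ c 2 ∣ r) (hp' : π ^ d 0 ∣ p')
    (hr' : π ^ d 2 ∣ r') (h₁ : p + y + q * z = y' + r') (h₂ : r + z = z' + p') :
    Rel π c d (s2Form y z) (s2Form y' z') := by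
  refine ⟨!![1, 0, 0; p, 1, q; r, 0, 1], !![1, 0, 0; p', 1, 0; r', q, 1],
    by simp [Matrix.det_fin_three], by simp [Matrix.det_fin_three],
    memC_of π c hp (dvd_zero _) hr, memC_of π d hp' hq hr', ?_⟩
  rw [mul_eq_mul_iff]
  intro i j
  fin_cases i <;> fin_cases j <;> simp [s2Form] <;> grind

theorem rel_s2Form_diag {π : R} {c d : Triple} (y z : R) (u v : Rˣ) :
    Rel π c d (s2Form y z) (s2Form (u * y) (v * z)) := by
  refine ⟨!![1, 0, 0; 0, u, 0; 0, 0, v], !![1, 0, 0; 0, v, 0; 0, 0, u],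
    by simp [Matrix.det_fin_three], by simp [Matrix.det_fin_three],
    memC_of π c (dvd_zero _) (dvd_zero _) (dvd_zero _),
    memC_of π d (dvd_zero _) (dvd_zero _) (dvd_zero _), ?_⟩
  rw [mul_eq_mul_iff]
  intro i j
  fin_cases i <;> fin_cases j <;> simp [s2Form]

/-! ### Reduction to the six Bruhat cells modulo the maximal ideal -/

/-- Clearing the first column with a unit in the third row. -/
theorem rel_pivot_three (π : R) (c d : Triple) {A : Matrix (Fin 3) (Fin 3) R}
    (h : IsUnit (A 2 0)) :
    ∃ a b e f : R, Rel π c d A !![0, a, b; 0, e, f; 1, 0, 0] := by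
  obtain ⟨q, hq⟩ := h.exists_right_inv
  refine ⟨A 0 1 - A 0 0 * q * A 2 1, A 0 2 - A 0 0 * q * A 2 2, A 1 1 - A 1 0 * q * A 2 1,
    A 1 2 - A 1 0 * q * A 2 2,
    !![1, 0, -(A 0 0 * q); 0, 1, -(A 1 0 * q); 0, 0, q],
    !![1, q * A 2 1, q * A 2 2; 0, 1, 0; 0, 0, 1],
    by simpa [Matrix.det_fin_three] using .of_mul_eq_one_right _ hq,
    by simp [Matrix.det_fin_three],
    memC_of π c (dvd_zero _) (dvd_zero _) (dvd_zero _),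
    memC_of π d (dvd_zero _) (dvd_zero _) (dvd_zero _), ?_⟩
  rw [mul_eq_mul_iff]
  intro i j
  fin_cases i <;> fin_cases j <;> simp <;> grind

/-- Clearing the first column above a unit in the second row. -/
theorem rel_pivot_two (π : R) (c d : Triple) {A : Matrix (Fin 3) (Fin 3) R}
    (h : IsUnit (A 1 0)) :
    ∃ a b e f : R, Rel π c d A !![0, a, b; 1, 0, 0; A 2 0, e, f] := by
  obtain ⟨q, hq⟩ := h.exists_right_inv
  refine ⟨A 0 1 - A 0 0 * q * A 1 1, A 0 2 - A 0 0 * q * A 1 2, A 2 1 - A 2 0 * q * A 1 1,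
    A 2 2 - A 2 0 * q * A 1 2,
    !![1, -(A 0 0 * q), 0; 0, q, 0; 0, 0, 1],
    !![1, q * A 1 1, q * A 1 2; 0, 1, 0; 0, 0, 1],
    by simpa [Matrix.det_fin_three] using .of_mul_eq_one_right _ hq,
    by simp [Matrix.det_fin_three],
    memC_of π c (dvd_zero _) (dvd_zero _) (dvd_zero _),
    memC_of π d (dvd_zero _) (dvd_zero _) (dvd_zero _), ?_⟩
  rw [mul_eq_mul_iff]
  intro i j
  fin_cases i <;> fin_cases j <;> simp <;> grind

/-- Normalising a unit in the upper left corner. -/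
theorem rel_pivot_one (π : R) (c d : Triple) {A : Matrix (Fin 3) (Fin 3) R}
    (h : IsUnit (A 0 0)) :
    ∃ a b e f : R, Rel π c d A !![1, 0, 0; A 1 0, a, b; A 2 0, e, f] := by
  obtain ⟨q, hq⟩ := h.exists_right_inv
  refine ⟨A 1 1 - A 1 0 * q * A 0 1, A 1 2 - A 1 0 * q * A 0 2, A 2 1 - A 2 0 * q * A 0 1,
    A 2 2 - A 2 0 * q * A 0 2,
    !![q, 0, 0; 0, 1, 0; 0, 0, 1],
    !![1, q * A 0 1, q * A 0 2; 0, 1, 0; 0, 0, 1],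
    by simpa [Matrix.det_fin_three] using .of_mul_eq_one_right _ hq,
    by simp [Matrix.det_fin_three],
    memC_of π c (dvd_zero _) (dvd_zero _) (dvd_zero _),
    memC_of π d (dvd_zero _) (dvd_zero _) (dvd_zero _), ?_⟩
  rw [mul_eq_mul_iff]
  intro i j
  fin_cases i <;> fin_cases j <;> simp <;> grind

theorem exists_inv_of_block_of_isUnit {a b e f q : R} (h : IsUnit (a * f - b * e))
    (hq : e * q = 1) : ∃ t, (b - a * q * f) * t = 1 := by
  refine IsUnit.exists_right_inv (isUnit_of_mul_isUnit_left (y := -e) ?_)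
  convert h using 1
  linear_combination (a * f) * hq

end Forms

section Bruhat

variable {R : Type*} [CommRing R] [IsLocalRing R]

theorem exists_inv_of_block_of_not_isUnit {a b e f : R} (h : IsUnit (a * f - b * e))
    (he : ¬ IsUnit e) : ∃ q s, a * q = 1 ∧ s * (f - e * q * b) = 1 := by
  have ha : IsUnit (a * f) := by
    by_contra hn
    rw [← mem_nonunits_iff, ← IsLocalRing.mem_maximalIdeal] at hn he
    exact (IsLocalRing.mem_maximalIdeal _).1 (sub_mem hn (Ideal.mul_mem_left _ b he)) h
  obtain ⟨q, hq⟩ := (isUnit_of_mul_isUnit_left ha).exists_right_inv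
  have : IsUnit (f - e * q * b) := by
    refine isUnit_of_mul_isUnit_left (y := a) ?_
    convert h using 1
    linear_combination (-b * e) * hq
  obtain ⟨s, hs⟩ := this.exists_left_inv
  exact ⟨q, s, hq, hs⟩

/-- Cells of matrices whose first column is reduced to the third unit vector: which of the two
occurs depends on whether the entry `e` is a unit. -/
theorem rel_w0_or_s2s1 (π : R) (c d : Triple) {a b e f : R} (h : IsUnit (a * f - b * e)) :
    Rel π c d !![0, a, b; 0, e, f; 1, 0, 0] w0Form ∨
      ∃ w, Rel π c d !![0, a, b; 0, e, f; 1, 0, 0] (s2s1Form w) := by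
  by_cases he : IsUnit e
  · obtain ⟨q, hq⟩ := he.exists_right_inv
    obtain ⟨t, ht⟩ := exists_inv_of_block_of_isUnit h hq
    refine .inl ⟨!![t, -(t * a * q), 0; 0, q, 0; 0, 0, 1], !![1, 0, 0; 0, 1, q * f; 0, 0, 1],
      ?_, by simp [Matrix.det_fin_three], memC_of π c (dvd_zero _) (dvd_zero _) (dvd_zero _),
      memC_of π d (dvd_zero _) (dvd_zero _) (dvd_zero _), ?_⟩
    · simpa [Matrix.det_fin_three] using
        IsUnit.mul (.of_mul_eq_one_right _ ht) (.of_mul_eq_one_right _ hq)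
    rw [mul_eq_mul_iff]
    intro i j
    fin_cases i <;> fin_cases j <;> simp [w0Form] <;> grind
  · obtain ⟨q, s, hq, hs⟩ := exists_inv_of_block_of_not_isUnit h he
    refine .inr ⟨s * e, !![q, 0, 0; 0, s, 0; 0, 0, 1], !![1, 0, 0; 0, 1, q * b; 0, 0, 1],
      ?_, by simp [Matrix.det_fin_three], memC_of π c (dvd_zero _) (dvd_zero _) (dvd_zero _),
      memC_of π d (dvd_zero _) (dvd_zero _) (dvd_zero _), ?_⟩
    · simpa [Matrix.det_fin_three] using
        IsUnit.mul (.of_mul_eq_one_right _ hq) (.of_mul_eq_one _ hs)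
    rw [mul_eq_mul_iff]
    intro i j
    fin_cases i <;> fin_cases j <;> simp [s2s1Form] <;> grind

/-- Cells of matrices whose first column is reduced to a pivot in the second row. -/
theorem rel_s1s2_or_s1 (π : R) (c d : Triple) {a b e f z : R} (h : IsUnit (a * f - b * e))
    (hz : ¬ IsUnit z) :
    (∃ z', Rel π c d !![0, a, b; 1, 0, 0; z, e, f] (s1s2Form z')) ∨
      ∃ z' w', ¬ IsUnit z' ∧ ¬ IsUnit w' ∧
        Rel π c d !![0, a, b; 1, 0, 0; z, e, f] (s1Form z' w') := by
  by_cases he : IsUnit e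
  · obtain ⟨q, hq⟩ := he.exists_right_inv
    obtain ⟨t, ht⟩ := exists_inv_of_block_of_isUnit h hq
    refine .inl ⟨q * z, !![t, t * a * q * z, -(t * a * q); 0, 1, 0; 0, 0, q],
      !![1, 0, 0; 0, 1, q * f; 0, 0, 1],
      ?_, by simp [Matrix.det_fin_three], memC_of π c (dvd_zero _) (dvd_zero _) (dvd_zero _),
      memC_of π d (dvd_zero _) (dvd_zero _) (dvd_zero _), ?_⟩
    · simpa [Matrix.det_fin_three] using
        IsUnit.mul (.of_mul_eq_one_right _ ht) (.of_mul_eq_one_right _ hq)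
    rw [mul_eq_mul_iff]
    intro i j
    fin_cases i <;> fin_cases j <;> simp [s1s2Form] <;> grind
  · obtain ⟨q, s, hq, hs⟩ := exists_inv_of_block_of_not_isUnit h he
    refine .inr ⟨s * z, s * e, fun h => hz (isUnit_of_mul_isUnit_right h),
      fun h => he (isUnit_of_mul_isUnit_right h),
      !![q, 0, 0; 0, 1, 0; 0, 0, s], !![1, 0, 0; 0, 1, q * b; 0, 0, 1],
      ?_, by simp [Matrix.det_fin_three], memC_of π c (dvd_zero _) (dvd_zero _) (dvd_zero _),
      memC_of π d (dvd_zero _) (dvd_zero _) (dvd_zero _), ?_⟩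
    · simpa [Matrix.det_fin_three] using
        IsUnit.mul (.of_mul_eq_one_right _ hq) (.of_mul_eq_one _ hs)
    rw [mul_eq_mul_iff]
    intro i j
    fin_cases i <;> fin_cases j <;> simp [s1Form] <;> grind

/-- Cells of matrices whose first column has its pivot in the first row. -/
theorem rel_s2_or_t (π : R) (c d : Triple) {a b e f y z : R} (h : IsUnit (a * f - b * e))
    (hy : ¬ IsUnit y) (hz : ¬ IsUnit z) :
    (∃ y' z', ¬ IsUnit y' ∧ ¬ IsUnit z' ∧
        Rel π c d !![1, 0, 0; y, a, b; z, e, f] (s2Form y' z')) ∨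
      ∃ y' z' w', ¬ IsUnit y' ∧ ¬ IsUnit z' ∧ ¬ IsUnit w' ∧
        Rel π c d !![1, 0, 0; y, a, b; z, e, f] (tForm y' z' w') := by
  by_cases he : IsUnit e
  · obtain ⟨q, hq⟩ := he.exists_right_inv
    obtain ⟨t, ht⟩ := exists_inv_of_block_of_isUnit h hq
    refine .inl ⟨t * (y - a * q * z), q * z, fun h => ?_, fun h => hz (isUnit_of_mul_isUnit_right h),
      !![1, 0, 0; 0, t, -(t * a * q); 0, 0, q], !![1, 0, 0; 0, 1, q * f; 0, 0, 1],
      ?_, by simp [Matrix.det_fin_three], memC_of π c (dvd_zero _) (dvd_zero _) (dvd_zero _),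
      memC_of π d (dvd_zero _) (dvd_zero _) (dvd_zero _), ?_⟩
    · rw [← mem_nonunits_iff, ← IsLocalRing.mem_maximalIdeal] at hy hz
      exact (IsLocalRing.mem_maximalIdeal _).1 (sub_mem hy (Ideal.mul_mem_left _ (a * q) hz))
        (isUnit_of_mul_isUnit_right h)
    · simpa [Matrix.det_fin_three] using
        IsUnit.mul (.of_mul_eq_one_right _ ht) (.of_mul_eq_one_right _ hq)
    rw [mul_eq_mul_iff]
    intro i j
    fin_cases i <;> fin_cases j <;> simp [s2Form] <;> grind
  · obtain ⟨q, s, hq, hs⟩ := exists_inv_of_block_of_not_isUnit h he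
    refine .inr ⟨q * y, s * z, s * e, fun h => hy (isUnit_of_mul_isUnit_right h),
      fun h => hz (isUnit_of_mul_isUnit_right h), fun h => he (isUnit_of_mul_isUnit_right h),
      !![1, 0, 0; 0, q, 0; 0, 0, s], !![1, 0, 0; 0, 1, q * b; 0, 0, 1],
      ?_, by simp [Matrix.det_fin_three], memC_of π c (dvd_zero _) (dvd_zero _) (dvd_zero _),
      memC_of π d (dvd_zero _) (dvd_zero _) (dvd_zero _), ?_⟩
    · simpa [Matrix.det_fin_three] using
        IsUnit.mul (.of_mul_eq_one_right _ hq) (.of_mul_eq_one _ hs)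
    rw [mul_eq_mul_iff]
    intro i j
    fin_cases i <;> fin_cases j <;> simp [tForm] <;> grind

/-- The Bruhat decomposition over the residue field, lifted to the ring by upper triangular
matrices (which lie in every `C_c`). -/
theorem rel_bruhat (π : R) {c d : Triple} (hc : c ∈ T) (hd : d ∈ T)
    {A : Matrix (Fin 3) (Fin 3) R} (hA : IsUnit A.det) :
    Rel π c d A w0Form ∨ (∃ w, Rel π c d A (s2s1Form w)) ∨ (∃ z, Rel π c d A (s1s2Form z)) ∨
      (∃ z w, ¬ IsUnit z ∧ ¬ IsUnit w ∧ Rel π c d A (s1Form z w)) ∨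
      (∃ y z, ¬ IsUnit y ∧ ¬ IsUnit z ∧ Rel π c d A (s2Form y z)) ∨
      ∃ y z w, ¬ IsUnit y ∧ ¬ IsUnit z ∧ ¬ IsUnit w ∧ Rel π c d A (tForm y z w) := by
  by_cases h3 : IsUnit (A 2 0)
  · obtain ⟨a, b, e, f, hr⟩ := rel_pivot_three π c d h3
    have hu : IsUnit (a * f - b * e) := by
      simpa [Matrix.det_fin_three, add_comm, ← sub_eq_add_neg] using hr.isUnit_det hA
    rcases rel_w0_or_s2s1 π c d hu with h | ⟨w, h⟩
    · exact .inl (hr.trans hc hd h)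
    · exact .inr (.inl ⟨w, hr.trans hc hd h⟩)
  by_cases h2 : IsUnit (A 1 0)
  · obtain ⟨a, b, e, f, hr⟩ := rel_pivot_two π c d h2
    have hu : IsUnit (a * f - b * e) := by
      rw [← IsUnit.neg_iff]
      simpa [Matrix.det_fin_three, add_comm, ← sub_eq_add_neg] using hr.isUnit_det hA
    rcases rel_s1s2_or_s1 π c d hu h3 with ⟨z, h⟩ | ⟨z, w, hz, hw, h⟩
    · exact .inr (.inr (.inl ⟨z, hr.trans hc hd h⟩))
    · exact .inr (.inr (.inr (.inl ⟨z, w, hz, hw, hr.trans hc hd h⟩)))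
  have h1 : IsUnit (A 0 0) := by
    by_contra h1
    rw [← mem_nonunits_iff, ← IsLocalRing.mem_maximalIdeal] at h1 h2 h3
    refine (IsLocalRing.mem_maximalIdeal _).1 ?_ hA
    have : A.det = (A 1 1 * A 2 2 - A 1 2 * A 2 1) * A 0 0 + (A 0 2 * A 2 1 - A 0 1 * A 2 2) * A 1 0
        + (A 0 1 * A 1 2 - A 0 2 * A 1 1) * A 2 0 := by
      rw [Matrix.det_fin_three]; ring
    rw [this]
    exact add_mem (add_mem (Ideal.mul_mem_left _ _ h1) (Ideal.mul_mem_left _ _ h2))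
      (Ideal.mul_mem_left _ _ h3)
  obtain ⟨a, b, e, f, hr⟩ := rel_pivot_one π c d h1
  have hu : IsUnit (a * f - b * e) := by
    simpa [Matrix.det_fin_three, add_comm, ← sub_eq_add_neg] using hr.isUnit_det hA
  rcases rel_s2_or_t π c d hu h2 h3 with ⟨y, z, hy, hz, h⟩ | ⟨y, z, w, hy, hz, hw, h⟩
  · exact .inr (.inr (.inr (.inr (.inl ⟨y, z, hy, hz, hr.trans hc hd h⟩))))
  · exact .inr (.inr (.inr (.inr (.inr ⟨y, z, w, hy, hz, hw, hr.trans hc hd h⟩))))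

end Bruhat

/-! ### Reduction of the entries to powers of the uniformizer -/

section Reduction

variable {R : Type*} [CommRing R] [IsDomain R] {π : R}

theorem pow_dvd_unit_mul_pow_iff (hπ : Irreducible π) (u : Rˣ) {m n : ℕ} :
    π ^ m ∣ u * π ^ n ↔ m ≤ n := by
  rw [Units.dvd_mul_left, pow_dvd_pow_iff hπ.ne_zero hπ.not_isUnit]

variable [IsDiscreteValuationRing R]

theorem not_isUnit_iff_dvd (hπ : Irreducible π) {r : R} : ¬ IsUnit r ↔ π ∣ r := by
  rw [← mem_nonunits_iff, ← IsLocalRing.mem_maximalIdeal, hπ.maximalIdeal_eq,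
    Ideal.mem_span_singleton]

/-- A unit of the form `1 + r` with `r` in the maximal ideal. -/
theorem isUnit_one_add (hπ : Irreducible π) {r : R} (h : π ∣ r) : IsUnit (1 + r) := by
  by_contra hu
  rw [not_isUnit_iff_dvd hπ] at hu
  exact hπ.not_dvd_one ((dvd_add_left h).1 hu)

theorem isUnit_add_of_dvd (hπ : Irreducible π) {u r : R} (hu : IsUnit u) (h : π ∣ r) :
    IsUnit (u + r) := by
  by_contra hn
  rw [not_isUnit_iff_dvd hπ] at hn
  exact (not_isUnit_iff_dvd hπ).2 ((dvd_add_left h).1 hn) hu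

theorem exists_unit_mul_pow_of_not_dvd (hπ : Irreducible π) {r : R} {e : ℕ}
    (h : ¬ π ^ (e + 1) ∣ r) : ∃ (u : Rˣ) (n : ℕ), n ≤ e ∧ r = u * π ^ n := by
  have hr : r ≠ 0 := by rintro rfl; exact h (dvd_zero _)
  obtain ⟨n, u, hn⟩ := IsDiscreteValuationRing.eq_unit_mul_pow_irreducible hr hπ
  refine ⟨u, n, ?_, hn⟩
  by_contra hlt
  exact h (hn ▸ (pow_dvd_pow π (by omega)).mul_left _)

/-- Every element of the maximal ideal agrees modulo `π ^ A` with a unit times a power `π ^ n`,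
`1 ≤ n ≤ A`. -/
theorem exists_unit_mul_pow_congr (hπ : Irreducible π) {r : R} {A : ℕ} (hA : 1 ≤ A) (h : π ∣ r) :
    ∃ (u : Rˣ) (n : ℕ), 1 ≤ n ∧ n ≤ A ∧ π ^ A ∣ u * π ^ n - r := by
  by_cases hr : π ^ A ∣ r
  · exact ⟨1, A, hA, le_rfl, dvd_sub (by simp) hr⟩
  · obtain ⟨u, n, hn, rfl⟩ := exists_unit_mul_pow_of_not_dvd (e := A - 1) hπ
      (by rwa [Nat.sub_add_cancel hA])
    refine ⟨u, n, ?_, by omega, by simp⟩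
    rw [← pow_dvd_unit_mul_pow_iff hπ u, pow_one]
    exact h

/-- Since `2` is a unit, an element `t` may be added or subtracted without raising the
valuation. -/
theorem exists_sign_add (hπ : Irreducible π) (h2 : IsUnit (2 : R)) (u : Rˣ) {e : ℕ} (he : 1 ≤ e)
    {t : R} (ht : π ∣ t) :
    ∃ (η v : Rˣ) (n : ℕ), 1 ≤ n ∧ n ≤ e ∧ u * π ^ e + η * t = v * π ^ n := by
  suffices ∃ η : Rˣ, ¬ π ^ (e + 1) ∣ u * π ^ e + η * t by
    obtain ⟨η, hη⟩ := this
    obtain ⟨v, n, hn, h⟩ := exists_unit_mul_pow_of_not_dvd hπ hη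
    refine ⟨η, v, n, ?_, hn, h⟩
    rw [← pow_dvd_unit_mul_pow_iff hπ v, pow_one, ← h]
    exact dvd_add ((dvd_pow_self π (by omega)).mul_left _) (ht.mul_left _)
  by_contra! hη
  have h := dvd_add (hη 1) (hη (-1))
  have h' : (u : R) * π ^ e + (1 : Rˣ) * t + (u * π ^ e + (-1 : Rˣ) * t)
      = ((h2.unit * u : Rˣ) : R) * π ^ e := by
    push_cast [IsUnit.unit_spec]; ring
  rw [h', pow_dvd_unit_mul_pow_iff hπ] at h
  omega

theorem exists_unit_add_pow (hπ : Irreducible π) (u η : Rˣ) {a n : ℕ} (h : n < a) :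
    ∃ v : Rˣ, u * π ^ a + η * π ^ n = v * π ^ n := by
  obtain ⟨v, hv⟩ := isUnit_add_of_dvd hπ η.isUnit (r := u * π ^ (a - n))
    ((dvd_pow_self π (by omega)).mul_left _)
  refine ⟨v, ?_⟩
  rw [hv, ← Nat.sub_add_cancel h.le, pow_add, Nat.add_sub_cancel]
  ring

/-- Reduction of a pair of elements of the maximal ideal to a pair of powers of `π`, for a
property invariant under the listed operations. Both `s₁`-type and `s₂`-type double cosets are
normalised in this way. -/
theorem exists_pow_pair (hπ : Irreducible π) (Q : R → R → Prop) {A B m n : ℕ} (hA : 1 ≤ A)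
    (hB : 1 ≤ B) (hy : ∀ y z ε, π ^ B ∣ ε → Q y z → Q (y + ε) z)
    (hz : ∀ y z ε, π ^ A ∣ ε → Q y z → Q y (z + ε))
    (hyz : ∀ y z ε, π ^ m ∣ ε → Q y z → Q y (z + ε * y))
    (hzy : ∀ y z ε, π ^ n ∣ ε → Q y z → Q (y + ε * z) z)
    (hu : ∀ y z (u v : Rˣ), Q y z → Q (u * y) (v * z)) {y z : R} (hQ : Q y z) (h1 : π ∣ y)
    (h2 : π ∣ z) :
    ∃ α β : ℕ, 1 ≤ α ∧ α ≤ A ∧ 1 ≤ β ∧ β ≤ B ∧ α ≤ β + m ∧ β ≤ α + n ∧ Q (π ^ β) (π ^ α) := by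
  obtain ⟨u, β, hβ1, hβ, hb⟩ := exists_unit_mul_pow_congr hπ hB h1
  obtain ⟨v, α, hα1, hα, ha⟩ := exists_unit_mul_pow_congr hπ hA h2
  have hQ' : Q (π ^ β) (π ^ α) := by
    have := hu _ _ u⁻¹ v⁻¹ (hz _ _ _ ha (hy _ _ _ hb hQ))
    simpa using this
  by_cases h : α ≤ β + m
  · by_cases h' : β ≤ α + n
    · exact ⟨α, β, hα1, hα, hβ1, hβ, h, h', hQ'⟩
    · refine ⟨α, α + n, hα1, hα, by omega, by omega, by omega, le_rfl, ?_⟩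
      convert hzy _ _ (π ^ n - π ^ (β - α)) (dvd_sub dvd_rfl (pow_dvd_pow π (by omega))) hQ' using 1
      rw [sub_mul, ← pow_add, ← pow_add, Nat.sub_add_cancel (by omega), add_comm α n]
      ring
  · refine ⟨β + m, β, by omega, by omega, hβ1, hβ, le_rfl, by omega, ?_⟩
    convert hyz _ _ (π ^ m - π ^ (α - β)) (dvd_sub dvd_rfl (pow_dvd_pow π (by omega))) hQ' using 1
    rw [sub_mul, ← pow_add, ← pow_add, Nat.sub_add_cancel (by omega), add_comm β m]
    ring

/-- Reduction of an `s₁`-type double coset to a distinguished representative. -/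
theorem exists_rel_s1Form (hπ : Irreducible π) {c d : Triple} (hc : c ∈ T) (hd : d ∈ T)
    (hc1 : 1 ≤ c 1) (hd1 : 1 ≤ d 1) {A : Matrix (Fin 3) (Fin 3) R} {z w : R}
    (hz : π ∣ z) (hw : π ∣ w) (h : Rel π c d A (s1Form z w)) :
    ∃ α β : ℕ, 1 ≤ α ∧ α ≤ min (d 1) (c 2) ∧ 1 ≤ β ∧ β ≤ min (c 1) (d 2) ∧
      α ≤ β + c 0 ∧ β ≤ α + d 0 ∧ Rel π c d A (s1Form (π ^ β) (π ^ α)) := by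
  have hc2 := hc.2.1
  have hd2 := hd.2.1
  refine exists_pow_pair hπ (fun z w => Rel π c d A (s1Form z w)) (by omega) (by omega)
    ?_ ?_ ?_ ?_ ?_ h hz hw
  · intro z w ε hε hr
    refine hr.trans hc hd ?_
    rcases min_choice (c 1) (d 2) with hm | hm <;> rw [hm] at hε
    · exact rel_s1Form_left (p := 0) (q := ε) (r := 0) (q' := 0) (r' := 0) (dvd_zero _) hε
        (dvd_zero _) (dvd_zero _) (dvd_zero _) (by ring) (by ring)
    · exact rel_s1Form_left (p := 0) (q := 0) (r := 0) (q' := 0) (r' := -ε) (dvd_zero _)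
        (dvd_zero _) (dvd_zero _) (dvd_zero _) ((dvd_neg).2 hε) (by ring) (by ring)
  · intro z w ε hε hr
    refine hr.trans hc hd ?_
    rcases min_choice (d 1) (c 2) with hm | hm <;> rw [hm] at hε
    · exact rel_s1Form_left (p := 0) (q := 0) (r := 0) (q' := -ε) (r' := 0) (dvd_zero _)
        (dvd_zero _) (dvd_zero _) ((dvd_neg).2 hε) (dvd_zero _) (by ring) (by ring)
    · exact rel_s1Form_left (p := 0) (q := 0) (r := ε) (q' := 0) (r' := 0) (dvd_zero _)
        (dvd_zero _) hε (dvd_zero _) (dvd_zero _) (by ring) (by ring)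
  · intro z w ε hε hr
    exact hr.trans hc hd (rel_s1Form_left (p := -ε) (q := 0) (r := 0) (q' := 0) (r' := 0)
      ((dvd_neg).2 hε) (dvd_zero _) (dvd_zero _) (dvd_zero _) (dvd_zero _) (by ring) (by ring))
  · intro z w ε hε hr
    exact hr.trans hc hd (rel_s1Form_right (p := -ε) (q := 0) (r := 0) (q' := 0) (r' := 0)
      ((dvd_neg).2 hε) (dvd_zero _) (dvd_zero _) (dvd_zero _) (dvd_zero _) (by ring) (by ring))
  · intro z w u v hr
    exact hr.trans hc hd (rel_s1Form_diag z w u v)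

/-- Reduction of an `s₂`-type double coset to a distinguished representative. -/
theorem exists_rel_s2Form (hπ : Irreducible π) {c d : Triple} (hc : c ∈ T) (hd : d ∈ T)
    (hc0 : 1 ≤ c 0) (hd0 : 1 ≤ d 0) {A : Matrix (Fin 3) (Fin 3) R} {y z : R}
    (hy : π ∣ y) (hz : π ∣ z) (h : Rel π c d A (s2Form y z)) :
    ∃ α β : ℕ, 1 ≤ α ∧ α ≤ min (d 0) (c 2) ∧ 1 ≤ β ∧ β ≤ min (c 0) (d 2) ∧
      α ≤ β + c 1 ∧ β ≤ α + d 1 ∧ Rel π c d A (s2Form (π ^ β) (π ^ α)) := by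
  have hc2 := hc.1
  have hd2 := hd.1
  refine exists_pow_pair hπ (fun y z => Rel π c d A (s2Form y z)) (by omega) (by omega)
    ?_ ?_ ?_ ?_ ?_ h hy hz
  · intro y z ε hε hr
    refine hr.trans hc hd ?_
    rcases min_choice (c 0) (d 2) with hm | hm <;> rw [hm] at hε
    · exact rel_s2Form_left (p := ε) (q := 0) (r := 0) (p' := 0) (r' := 0) hε (dvd_zero _)
        (dvd_zero _) (dvd_zero _) (dvd_zero _) (by ring) (by ring)
    · exact rel_s2Form_left (p := 0) (q := 0) (r := 0) (p' := 0) (r' := -ε) (dvd_zero _)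
        (dvd_zero _) (dvd_zero _) (dvd_zero _) ((dvd_neg).2 hε) (by ring) (by ring)
  · intro y z ε hε hr
    refine hr.trans hc hd ?_
    rcases min_choice (d 0) (c 2) with hm | hm <;> rw [hm] at hε
    · exact rel_s2Form_left (p := 0) (q := 0) (r := 0) (p' := -ε) (r' := 0) (dvd_zero _)
        (dvd_zero _) (dvd_zero _) ((dvd_neg).2 hε) (dvd_zero _) (by ring) (by ring)
    · exact rel_s2Form_left (p := 0) (q := 0) (r := ε) (p' := 0) (r' := 0) (dvd_zero _)
        (dvd_zero _) hε (dvd_zero _) (dvd_zero _) (by ring) (by ring)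
  · intro y z ε hε hr
    exact hr.trans hc hd (rel_s2Form_left (p := 0) (q := ε) (r := 0) (p' := 0) (r' := 0)
      (dvd_zero _) hε (dvd_zero _) (dvd_zero _) (dvd_zero _) (by ring) (by ring))
  · intro y z ε hε hr
    exact hr.trans hc hd (rel_s2Form_right (p := 0) (q := ε) (r := 0) (p' := 0) (r' := 0)
      (dvd_zero _) hε (dvd_zero _) (dvd_zero _) (dvd_zero _) (by ring) (by ring))
  · intro y z u v hr
    exact hr.trans hc hd (rel_s2Form_diag y z u v)

/-- Reduction of a double coset that meets the lower unipotent matrices to a representative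
`t_{a,x}`. The exponents are those of a matrix `tForm y z w` in the double coset for which the
sum of the valuations of `y`, `z`, `w` is minimal: whenever one of the inequalities fails, some
operation lowers one valuation and does not raise the two others. -/
theorem exists_rel_tForm (hπ : Irreducible π) (h2 : IsUnit (2 : R)) {c d : Triple} (hc : c ∈ T)
    (hd : d ∈ T) (hc0 : 1 ≤ c 0) (hc1 : 1 ≤ c 1) (hd0 : 1 ≤ d 0) (hd1 : 1 ≤ d 1)
    {A : Matrix (Fin 3) (Fin 3) R} {y z w : R} (hy : π ∣ y) (hz : π ∣ z) (hw : π ∣ w)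
    (h : Rel π c d A (tForm y z w)) :
    ∃ a ∈ T1, a ≤ c ∧ a ≤ d ∧ a 2 ≤ min (a 0 + c 1) (d 0 + a 1) ∧ ∃ x : Rˣ,
      Rel π c d A (tForm (π ^ a 0) (x * π ^ a 2) (π ^ a 1)) := by
  classical
  have hc2 := hc.1
  have hd2 := hd.1
  have pow_dvd : ∀ {n : ℕ} (ε : R), 1 ≤ n → π ∣ ε * π ^ n := fun ε hn =>
    (dvd_pow_self π (by omega)).mul_left ε
  let P : ℕ → ℕ → ℕ → Prop := fun a b e => 1 ≤ a ∧ 1 ≤ b ∧ 1 ≤ e ∧ ∃ u v x : Rˣ,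
    Rel π c d A (tForm (u * π ^ a) (x * π ^ e) (v * π ^ b))
  have hex : ∃ n a b e, a + b + e = n ∧ P a b e := by
    obtain ⟨u, a, ha1, -, ha⟩ := exists_unit_mul_pow_congr hπ hc0 hy
    obtain ⟨v, b, hb1, -, hb⟩ := exists_unit_mul_pow_congr hπ hd1 hw
    obtain ⟨x, e, he1, -, he⟩ := exists_unit_mul_pow_congr hπ (hc0.trans hc2) hz
    refine ⟨_, a, b, e, rfl, ha1, hb1, he1, u, v, x, h.trans hc hd ?_⟩
    exact rel_tForm_lower (q := 0) (p' := 0) (r' := 0) ha (dvd_zero _) he (dvd_zero _)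
      ((dvd_neg).2 hb) (dvd_zero _) (by ring) (by ring) (by ring)
  obtain ⟨a, b, e, hn, ha1, hb1, he1, u, v, x, hr⟩ := Nat.find_spec hex
  have hmin : ∀ a' b' e', 1 ≤ a' → 1 ≤ b' → 1 ≤ e' → ∀ u' v' x' : Rˣ,
      Rel π c d (tForm (u * π ^ a) (x * π ^ e) (v * π ^ b))
        (tForm (u' * π ^ a') (x' * π ^ e') (v' * π ^ b')) → a + b + e ≤ a' + b' + e' := by
    intro a' b' e' h1 h2 h3 u' v' x' hr'
    rw [hn]
    exact Nat.find_min' hex ⟨a', b', e', rfl, h1, h2, h3, u', v', x', hr.trans hc hd hr'⟩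
  have hec : e ≤ c 2 := by
    by_contra! hlt
    obtain ⟨x', hx'⟩ := exists_unit_add_pow hπ x 1 hlt
    have := hmin a b (c 2) ha1 hb1 (hc0.trans hc2) u v x' (by
      rw [← hx']
      exact rel_tForm_lower (p := 0) (q := 0) (r := π ^ c 2) (p' := 0) (q' := 0) (r' := 0)
        (dvd_zero _) (dvd_zero _) dvd_rfl (dvd_zero _) (dvd_zero _) (dvd_zero _)
        (by ring) (by ring) (by push_cast; ring))
    omega
  have hed : e ≤ d 2 := by
    by_contra! hlt
    obtain ⟨x', hx'⟩ := exists_unit_add_pow hπ x 1 hlt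
    have := hmin a b (d 2) ha1 hb1 (hd0.trans hd2) u v x' (by
      rw [← hx']
      exact rel_tForm_lower (p := 0) (q := 0) (r := 0) (p' := 0) (q' := 0) (r' := -π ^ d 2)
        (dvd_zero _) (dvd_zero _) (dvd_zero _) (dvd_zero _) (dvd_zero _) ((dvd_neg).2 dvd_rfl)
        (by ring) (by ring) (by push_cast; ring))
    omega
  have hac : a ≤ c 0 := by
    by_contra! hlt
    obtain ⟨u', hu'⟩ := exists_unit_add_pow hπ u 1 hlt
    have := hmin (c 0) b e hc0 hb1 he1 u' v x (by
      rw [← hu']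
      exact rel_tForm_lower (p := π ^ c 0) (q := 0) (r := 0) (p' := 0) (q' := 0) (r' := 0)
        dvd_rfl (dvd_zero _) (dvd_zero _) (dvd_zero _) (dvd_zero _) (dvd_zero _)
        (by push_cast; ring) (by ring) (by ring))
    omega
  have hbd : b ≤ d 1 := by
    by_contra! hlt
    obtain ⟨v', hv'⟩ := exists_unit_add_pow hπ v 1 hlt
    have := hmin a (d 1) e ha1 hd1 he1 u v' x (by
      rw [← hv']
      exact rel_tForm_lower (p := 0) (q := 0) (r := 0) (p' := 0) (q' := -π ^ d 1) (r' := 0)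
        (dvd_zero _) (dvd_zero _) (dvd_zero _) (dvd_zero _) ((dvd_neg).2 dvd_rfl) (dvd_zero _)
        (by ring) (by push_cast; ring) (by ring))
    omega
  have hae : a ≤ e := by
    by_contra! hlt
    obtain ⟨s, hs⟩ := isUnit_one_add hπ (pow_dvd (v : R) hb1)
    obtain ⟨u', hu'⟩ := exists_unit_add_pow hπ u x hlt
    have := hmin e b e he1 hb1 he1 (s⁻¹ * u') (s * v) (s * x) (by
      have := rel_tForm_add_left (π := π) (c := c) (d := d) (u * π ^ a) (x * π ^ e) (v * π ^ b) s hs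
      rw [hu'] at this
      simpa [mul_assoc] using this)
    omega
  have hbe : b ≤ e := by
    by_contra! hlt
    obtain ⟨s, hs⟩ := isUnit_one_add hπ (pow_dvd (u : R) ha1)
    obtain ⟨v', hv'⟩ := exists_unit_add_pow hπ v x hlt
    have := hmin a e e ha1 he1 he1 (s * u) (s⁻¹ * v') (s * x) (by
      have := rel_tForm_add_right (π := π) (c := c) (d := d) (u * π ^ a) (x * π ^ e) (v * π ^ b) s hs
      rw [hv'] at this
      simpa [mul_assoc] using this)
    omega
  have heac : e ≤ a + c 1 := by
    by_contra! hlt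
    obtain ⟨η, v', b', hb'1, hb', hv'⟩ := exists_sign_add hπ h2 v hb1 (dvd_pow_self π (by omega : c 1 ≠ 0))
    obtain ⟨x', hx'⟩ := exists_unit_add_pow hπ x (η * u) hlt
    have := hmin a b' (a + c 1) ha1 hb'1 (by omega) u v' x' (by
      rw [← hv', ← hx']
      exact rel_tForm_lower (p := 0) (q := η * π ^ c 1) (r := 0) (p' := 0) (q' := 0) (r' := 0)
        (dvd_zero _) (dvd_mul_left _ _) (dvd_zero _) (dvd_zero _) (dvd_zero _) (dvd_zero _)
        (by ring) (by ring) (by push_cast; ring))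
    omega
  have hebd : e ≤ d 0 + b := by
    by_contra! hlt
    obtain ⟨η, u', a', ha'1, ha', hu'⟩ := exists_sign_add hπ h2 u ha1 (dvd_pow_self π (by omega : d 0 ≠ 0))
    obtain ⟨x', hx'⟩ := exists_unit_add_pow hπ x (η * v) hlt
    have := hmin a' b (d 0 + b) ha'1 hb1 (by omega) u' v x' (by
      rw [← hu', ← hx']
      exact rel_tForm_lower (p := 0) (q := 0) (r := 0) (p' := -(η * π ^ d 0)) (q' := 0) (r' := 0)
        (dvd_zero _) (dvd_zero _) (dvd_zero _) ((dvd_neg).2 (dvd_mul_left _ _)) (dvd_zero _)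
        (dvd_zero _) (by ring) (by ring) (by push_cast; ring))
    omega
  have had : a ≤ d 0 := by
    by_contra! hlt
    obtain ⟨η, x', e', he'1, he', hx'⟩ := exists_sign_add hπ h2 x he1
      (t := v * π ^ b * π ^ d 0) ((pow_dvd _ hb1).mul_right _)
    obtain ⟨u', hu'⟩ := exists_unit_add_pow hπ u η hlt
    have := hmin (d 0) b e' hd0 hb1 he'1 u' v x' (by
      rw [← hu', ← hx']
      exact rel_tForm_lower (p := 0) (q := 0) (r := 0) (p' := -(η * π ^ d 0)) (q' := 0) (r' := 0)
        (dvd_zero _) (dvd_zero _) (dvd_zero _) ((dvd_neg).2 (dvd_mul_left _ _)) (dvd_zero _)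
        (dvd_zero _) (by ring) (by ring) (by ring))
    omega
  have hbc : b ≤ c 1 := by
    by_contra! hlt
    obtain ⟨η, x', e', he'1, he', hx'⟩ := exists_sign_add hπ h2 x he1
      (t := u * π ^ a * π ^ c 1) ((pow_dvd _ ha1).mul_right _)
    obtain ⟨v', hv'⟩ := exists_unit_add_pow hπ v η hlt
    have := hmin a (c 1) e' ha1 hc1 he'1 u v' x' (by
      rw [← hv', ← hx']
      exact rel_tForm_lower (p := 0) (q := η * π ^ c 1) (r := 0) (p' := 0) (q' := 0) (r' := 0)
        (dvd_zero _) (dvd_mul_left _ _) (dvd_zero _) (dvd_zero _) (dvd_zero _) (dvd_zero _)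
        (by ring) (by ring) (by ring))
    omega
  refine ⟨![a, b, e], ⟨ha1, hb1, hae, hbe⟩, ?_, ?_, ?_, u⁻¹ * v⁻¹ * x, ?_⟩
  · intro i; fin_cases i <;> simp [hac, hbc, hec]
  · intro i; fin_cases i <;> simp [had, hbd, hed]
  · exact le_min heac hebd
  · have := hr.trans hc hd (rel_tForm_diag _ _ _ u⁻¹ v⁻¹)
    simpa [mul_assoc] using this

end Reduction

/-! ### Support of intertwining operators: the matrix computations -/

section Support

variable {R : Type*} [CommRing R]

/-- What is used of the functions `e₂`, `e₃` by which the characters `χ₂`, `χ₃` enter (in the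
application `extChar χ₂`, `extChar χ₃`): invariance modulo `π ^ M` and `π ^ N`, and minimality of
the conductors `M` of `χ₂` and `N` of `χ₃` and of `χ₂ / χ₃`. -/
structure CharPair (π : R) (M N : ℕ) (e₂ e₃ : R → ℂ) : Prop where
  one₂ : e₂ 1 = 1
  one₃ : e₃ 1 = 1
  ne_zero₂ : ∀ r, e₂ r ≠ 0
  congr₂ : ∀ r s, π ^ M ∣ r - s → e₂ r = e₂ s
  congr₃ : ∀ r s, π ^ N ∣ r - s → e₃ r = e₃ s
  nontrivial₃ : ∃ u : Rˣ, e₃ u ≠ 1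
  le₂ : ∀ n, 1 ≤ n → (∀ v, e₂ (1 + π ^ n * v) = 1) → M ≤ n
  le₃ : ∀ n, 1 ≤ n → (∀ v, e₃ (1 + π ^ n * v) = 1) → N ≤ n
  le₂₃ : ∀ n, 1 ≤ n → (∀ v, e₂ (1 + π ^ n * v) = e₃ (1 + π ^ n * v)) → N ≤ n

/-- The condition on `A` under which `C_c A C_d` supports an intertwining operator: the characters
agree whenever `G A = A H`. -/
def MatSupports (π : R) (e₂ e₃ : R → ℂ) (c d : Triple) (A : Matrix (Fin 3) (Fin 3) R) : Prop :=
  ∀ G H : Matrix (Fin 3) (Fin 3) R, IsUnit G.det → IsUnit H.det → MemC π c G → MemC π d H →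
    G * A = A * H → e₂ (G 1 1) * e₃ (G 2 2) = e₂ (H 1 1) * e₃ (H 2 2)

variable {π : R} {M N : ℕ} {e₂ e₃ : R → ℂ} {c d : Triple}

theorem not_matSupports_w0Form (he : CharPair π M N e₂ e₃) : ¬ MatSupports π e₂ e₃ c d w0Form := by
  intro h
  obtain ⟨u, hu⟩ := he.nontrivial₃
  refine hu ?_
  have := h !![1, 0, 0; 0, 1, 0; 0, 0, u] !![u, 0, 0; 0, 1, 0; 0, 0, 1]
    (by simp [Matrix.det_fin_three]) (by simp [Matrix.det_fin_three])
    (memC_of π c (dvd_zero _) (dvd_zero _) (dvd_zero _))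
    (memC_of π d (dvd_zero _) (dvd_zero _) (dvd_zero _)) (by
      rw [mul_eq_mul_iff]
      intro i j
      fin_cases i <;> fin_cases j <;> simp [w0Form])
  simpa [he.one₂, he.one₃] using this

theorem not_matSupports_s1s2Form (he : CharPair π M N e₂ e₃) (z : R) :
    ¬ MatSupports π e₂ e₃ c d (s1s2Form z) := by
  intro h
  obtain ⟨u, hu⟩ := he.nontrivial₃
  refine hu ?_
  have := h !![u, 0, 0; 0, 1, 0; 0, 0, 1] !![1, 0, 0; 0, 1, 0; 0, 0, u]
    (by simp [Matrix.det_fin_three]) (by simp [Matrix.det_fin_three])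
    (memC_of π c (dvd_zero _) (dvd_zero _) (dvd_zero _))
    (memC_of π d (dvd_zero _) (dvd_zero _) (dvd_zero _)) (by
      rw [mul_eq_mul_iff]
      intro i j
      fin_cases i <;> fin_cases j <;> simp [s1s2Form])
  simpa [he.one₂, he.one₃] using this.symm

theorem not_matSupports_s2s1Form (he : CharPair π M N e₂ e₃) (w : R) :
    ¬ MatSupports π e₂ e₃ c d (s2s1Form w) := by
  intro h
  obtain ⟨u, hu⟩ := he.nontrivial₃
  refine hu ?_
  have := h !![1, 0, 0; 0, 1, 0; 0, 0, u] !![u, 0, 0; 0, 1, 0; 0, 0, 1]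
    (by simp [Matrix.det_fin_three]) (by simp [Matrix.det_fin_three])
    (memC_of π c (dvd_zero _) (dvd_zero _) (dvd_zero _))
    (memC_of π d (dvd_zero _) (dvd_zero _) (dvd_zero _)) (by
      rw [mul_eq_mul_iff]
      intro i j
      fin_cases i <;> fin_cases j <;> simp [s2s1Form])
  simpa [he.one₂, he.one₃] using this

theorem matSupports_tForm_one (he : CharPair π M N e₂ e₃) (hMN : M ≤ N) {a : Triple}
    (hsum : a 0 + a 1 = a 2) (h0 : M ≤ a 0) (h1 : N ≤ a 1) :
    MatSupports π e₂ e₃ c d (tForm (π ^ a 0) (π ^ a 2) (π ^ a 1)) := by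
  intro G H _ _ _ _ h
  rw [mul_eq_mul_iff] at h
  simp [Fin.forall_fin_succ, tForm, ← hsum, pow_add] at h
  obtain ⟨-, ⟨-, e5, -⟩, -, -, e9⟩ := h
  rw [he.congr₂ (G 1 1) (H 1 1) ?_, he.congr₃ (G 2 2) (H 2 2) ?_]
  · have : G 2 2 - H 2 2 = π ^ a 1 * (π ^ a 0 * H 0 2 + H 1 2) := by linear_combination e9
    rw [this]
    exact (pow_dvd_pow π h1).mul_right _
  · have : G 1 1 - H 1 1 = π ^ a 0 * H 0 1 - π ^ a 1 * G 1 2 := by linear_combination e5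
    rw [this]
    exact dvd_sub ((pow_dvd_pow π h0).mul_right _) ((pow_dvd_pow π (hMN.trans h1)).mul_right _)

variable [IsDomain R]

theorem dvd_of_pow_dvd_pow_mul {m k n : ℕ} {r : R} (hπ : Irreducible π) (hn : m + k ≤ n)
    (h : π ^ n ∣ π ^ m * r) : π ^ k ∣ r := by
  have := (pow_dvd_pow π hn).trans h
  rwa [pow_add, mul_dvd_mul_iff_left (pow_ne_zero _ hπ.ne_zero)] at this

theorem matSupports_s1Form (he : CharPair π M N e₂ e₃) (hπ : Irreducible π) (hMN : M ≤ N)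
    {α β n : ℕ} (hα : N ≤ α) (hβ : N ≤ β) (hn : α + β + N ≤ n) (hc : ∀ i, n ≤ c i)
    (hd : ∀ i, n ≤ d i) : MatSupports π e₂ e₃ c d (s1Form (π ^ β) (π ^ α)) := by
  intro G H _ _ hG hH h
  obtain ⟨g1, g2, g3⟩ := hG.mono (c := fun _ => n) hc
  obtain ⟨k1, k2, k3⟩ := hH.mono (c := fun _ => n) hd
  rw [mul_eq_mul_iff] at h
  simp [Fin.forall_fin_succ, s1Form] at h
  obtain ⟨⟨e1, e2, e3⟩, ⟨e4, e5, e6⟩, e7, e8, e9⟩ := h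
  have hβ' : π ^ N ∣ π ^ β := pow_dvd_pow π hβ
  have hα' : π ^ N ∣ π ^ α := pow_dvd_pow π hα
  have h1 : π ^ N ∣ G 2 2 - H 0 0 := by
    refine dvd_of_pow_dvd_pow_mul (m := β) (n := n) hπ (by omega) ?_
    have : π ^ β * (G 2 2 - H 0 0) = π ^ α * H 1 0 + H 2 0 - G 2 1 := by
      linear_combination e7
    rw [this]
    exact dvd_sub (dvd_add (k1.mul_left _) k3) g2
  have h2 : π ^ N ∣ G 2 2 - H 1 1 - π ^ β * G 1 2 := by
    refine dvd_of_pow_dvd_pow_mul (m := α) (n := n) hπ (by omega) ?_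
    have : π ^ α * (G 2 2 - H 1 1 - π ^ β * G 1 2) = π ^ β * G 1 0 + H 2 1 - G 2 0 := by
      linear_combination e8 - π ^ β * e5
    rw [this]
    exact dvd_sub (dvd_add (g1.mul_left _) k2) g3
  rw [he.congr₂ (G 1 1) (H 1 1) ((pow_dvd_pow π hMN).trans ?_), he.congr₃ (G 2 2) (H 2 2) ?_]
  · rw [e9, add_sub_cancel_right]
    exact dvd_add (hβ'.mul_right _) (hα'.mul_right _)
  · have : G 1 1 - H 1 1 = (G 2 2 - H 1 1 - π ^ β * G 1 2) - (G 2 2 - H 0 0) := by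
      linear_combination e4
    rw [this]
    exact dvd_sub h2 h1

theorem matSupports_s2Form (he : CharPair π M N e₂ e₃) (hπ : Irreducible π) (hMN : M ≤ N)
    {α β n : ℕ} (hα : N ≤ α) (hβ : N ≤ β) (hn : α + β + N ≤ n) (hc : ∀ i, n ≤ c i)
    (hd : ∀ i, n ≤ d i) : MatSupports π e₂ e₃ c d (s2Form (π ^ β) (π ^ α)) := by
  intro G H _ _ hG hH h
  obtain ⟨g1, g2, g3⟩ := hG.mono (c := fun _ => n) hc
  obtain ⟨k1, k2, k3⟩ := hH.mono (c := fun _ => n) hd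
  rw [mul_eq_mul_iff] at h
  simp [Fin.forall_fin_succ, s2Form] at h
  obtain ⟨⟨e1, e2, e3⟩, ⟨e4, e5, e6⟩, e7, e8, e9⟩ := h
  have hβ' : π ^ N ∣ π ^ β := pow_dvd_pow π hβ
  have hα' : π ^ N ∣ π ^ α := pow_dvd_pow π hα
  have h1 : π ^ N ∣ G 1 1 - H 0 0 + π ^ α * H 0 1 := by
    refine dvd_of_pow_dvd_pow_mul (m := β) (n := n) hπ (by omega) ?_
    have : π ^ β * (G 1 1 - H 0 0 + π ^ α * H 0 1) = H 2 0 - G 1 0 - π ^ α * H 2 1 := by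
      linear_combination e4 - π ^ α * e5
    rw [this]
    exact dvd_sub (dvd_sub k3 g1) (k2.mul_left _)
  have h2 : π ^ N ∣ G 2 2 - H 0 0 := by
    refine dvd_of_pow_dvd_pow_mul (m := α) (n := n) hπ (by omega) ?_
    have : π ^ α * (G 2 2 - H 0 0) = H 1 0 - G 2 0 - G 2 1 * π ^ β := by
      linear_combination e7
    rw [this]
    exact dvd_sub (dvd_sub k1 g3) (g2.mul_right _)
  have h3 : π ^ N ∣ G 1 1 - G 2 2 := by
    have : G 1 1 - G 2 2 = (G 1 1 - H 0 0 + π ^ α * H 0 1) - (G 2 2 - H 0 0) - π ^ α * H 0 1 := by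
      ring
    rw [this]
    exact dvd_sub (dvd_sub h1 h2) (hα'.mul_right _)
  rw [he.congr₂ (G 1 1) (H 1 1) ((pow_dvd_pow π hMN).trans ?_), he.congr₃ (G 2 2) (H 2 2) ?_]
  · have : G 2 2 - H 2 2 = π ^ β * H 0 2 - (G 1 1 - G 2 2) := by linear_combination e6
    rw [this]
    exact dvd_sub (hβ'.mul_right _) h3
  · have : G 1 1 - H 1 1 = (G 1 1 - G 2 2) + π ^ α * H 0 1 := by linear_combination e8
    rw [this]
    exact dvd_add h3 (hα'.mul_right _)

theorem matSupports_tForm (he : CharPair π M N e₂ e₃) (hπ : Irreducible π) (hMN : M ≤ N)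
    {a : Triple} (ha : a ∈ T1) (x u : Rˣ) {δ n : ℕ}
    (hD : x * π ^ a 2 - π ^ a 0 * π ^ a 1 = u * π ^ δ) (hmax : N ≤ max (a 0) (a 1))
    (hn : a 2 + δ + N ≤ n) (hc : ∀ i, n ≤ c i) (hd : ∀ i, n ≤ d i) :
    MatSupports π e₂ e₃ c d (tForm (π ^ a 0) (x * π ^ a 2) (π ^ a 1)) := by
  obtain ⟨-, -, h02, h12⟩ := ha
  intro G H _ _ hG hH h
  obtain ⟨g1, g2, g3⟩ := hG.mono (c := fun _ => n) hc
  obtain ⟨k1, k2, k3⟩ := hH.mono (c := fun _ => n) hd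
  rw [mul_eq_mul_iff] at h
  simp [Fin.forall_fin_succ, tForm] at h
  obtain ⟨⟨e1, e2, e3⟩, ⟨e4, e5, e6⟩, e7, e8, e9⟩ := h
  have h1 : π ^ (δ + N) ∣ G 2 2 - H 0 0 := by
    refine dvd_of_pow_dvd_pow_mul (m := a 2) (n := n) hπ (by omega) ?_
    rw [← Units.dvd_mul_left (u := x)]
    have : x * (π ^ a 2 * (G 2 2 - H 0 0)) =
        π ^ a 1 * H 1 0 + H 2 0 - G 2 0 - G 2 1 * π ^ a 0 := by
      linear_combination e7
    rw [this]
    exact dvd_sub (dvd_sub (dvd_add (k1.mul_left _) k3) g3) (g2.mul_right _)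
  -- Eliminating `G₂₂` and `H₂₂` leaves a multiple of `x π ^ a₃ - π ^ a₁ π ^ a₂`.
  have h2 : π ^ N ∣ π ^ a 1 * G 1 2 - π ^ a 0 * H 0 1 := by
    refine dvd_of_pow_dvd_pow_mul (m := δ) (n := δ + N) hπ le_rfl ?_
    rw [← Units.dvd_mul_left (u := u), ← mul_assoc, ← hD]
    have : (x * π ^ a 2 - π ^ a 0 * π ^ a 1) * (π ^ a 1 * G 1 2 - π ^ a 0 * H 0 1) =
        π ^ a 1 * (H 1 0 - G 1 0) + π ^ a 0 * (H 2 1 - G 2 1) -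
          π ^ a 0 * π ^ a 1 * (G 2 2 - H 0 0) := by
      linear_combination π ^ a 1 * e4 + π ^ a 0 * e8 - π ^ a 0 * π ^ a 1 * e5
    rw [this]
    have hn' : π ^ (δ + N) ∣ π ^ n := pow_dvd_pow π (by omega)
    exact dvd_sub (dvd_add ((hn'.trans (dvd_sub k1 g1)).mul_left _)
      ((hn'.trans (dvd_sub k2 g2)).mul_left _)) (h1.mul_left _)
  rw [he.congr₂ (G 1 1) (H 1 1) ((pow_dvd_pow π hMN).trans ?_), he.congr₃ (G 2 2) (H 2 2) ?_]
  · have hz : π ^ N ∣ π ^ a 2 := pow_dvd_pow π (by omega)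
    have hy : π ^ N ∣ π ^ a 0 * π ^ a 1 := by rw [← pow_add]; exact pow_dvd_pow π (by omega)
    have hw : π ^ N ∣ π ^ a 1 * G 1 2 := by
      rcases le_max_iff.1 hmax with h | h
      · rw [← dvd_sub_left ((pow_dvd_pow π h).mul_right (H 0 1))]
        exact h2
      · exact (pow_dvd_pow π h).mul_right _
    have : G 2 2 - H 2 2 = π ^ a 2 * (x * H 0 2) + π ^ a 1 * G 1 2 - π ^ a 0 * π ^ a 1 * H 0 2 := by
      linear_combination e9 - π ^ a 1 * e6
    rw [this]
    exact dvd_sub (dvd_add (hz.mul_right _) hw) (hy.mul_right _)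
  · have : G 1 1 - H 1 1 = -(π ^ a 1 * G 1 2 - π ^ a 0 * H 0 1) := by linear_combination e5
    rw [this]
    exact (dvd_neg).2 h2

variable [IsDiscreteValuationRing R]

theorem MatSupports.s1Form_eq_one (he : CharPair π M N e₂ e₃) (hπ : Irreducible π) {z w : R}
    (hz : π ∣ z) (hw : π ∣ w) (h : MatSupports π e₂ e₃ c d (s1Form z w)) (u v : R) :
    e₃ (1 + z * v + w * u) = 1 := by
  have h1 : IsUnit (1 + z * v) := isUnit_one_add hπ (hz.mul_right _)
  have h2 : IsUnit (1 + z * v + w * u) := isUnit_add_of_dvd hπ h1 (hw.mul_right _)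
  have := h !![1 + z * v + w * u, z * u, -u; 0, 1 + z * v, -v; 0, 0, 1]
    !![1, -(w * v), -v; 0, 1 + z * v, -u; 0, 0, 1 + z * v + w * u]
    (by simpa [Matrix.det_fin_three] using h2.mul h1)
    (by simpa [Matrix.det_fin_three] using h1.mul h2)
    (memC_of π c (dvd_zero _) (dvd_zero _) (dvd_zero _))
    (memC_of π d (dvd_zero _) (dvd_zero _) (dvd_zero _)) (by
      rw [mul_eq_mul_iff]
      intro i j
      fin_cases i <;> fin_cases j <;> simp [s1Form] <;> ring)
  simpa [he.one₃, he.ne_zero₂] using this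

theorem MatSupports.s2Form_eq_one (he : CharPair π M N e₂ e₃) (hπ : Irreducible π) {y z : R}
    (hy : π ∣ y) (hz : π ∣ z) (h : MatSupports π e₂ e₃ c d (s2Form y z)) (u v : R) :
    e₃ (1 + y * v + z * u) = 1 := by
  have h1 : IsUnit (1 + y * v) := isUnit_one_add hπ (hy.mul_right _)
  have h2 : IsUnit (1 + y * v + z * u) := isUnit_add_of_dvd hπ h1 (hz.mul_right _)
  have := h !![1, v, u; 0, 1 + y * v, y * u; 0, 0, 1 + y * v + z * u]
    !![1 + y * v + z * u, u, v; 0, 1 + y * v, -(z * v); 0, 0, 1]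
    (by simpa [Matrix.det_fin_three] using h1.mul h2)
    (by simpa [Matrix.det_fin_three] using h2.mul h1)
    (memC_of π c (dvd_zero _) (dvd_zero _) (dvd_zero _))
    (memC_of π d (dvd_zero _) (dvd_zero _) (dvd_zero _)) (by
      rw [mul_eq_mul_iff]
      intro i j
      fin_cases i <;> fin_cases j <;> simp [s2Form] <;> ring)
  simpa [he.one₃, he.ne_zero₂] using this

/-- The character `e₃` is trivial on `1 + (z)`: upper triangular pairs realize the diagonal
entries `(1, 1, 1 + z u)` on the left and `(1 + z u, 1, 1)` on the right. -/
theorem MatSupports.tForm_eq_one (he : CharPair π M N e₂ e₃) (hπ : Irreducible π) {y z w : R}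
    (hz : π ∣ z) (h : MatSupports π e₂ e₃ c d (tForm y z w)) (u : R) :
    e₃ (1 + z * u) = 1 := by
  have h1 : IsUnit (1 + z * u) := isUnit_one_add hπ (hz.mul_right _)
  have := h !![1, 0, u; 0, 1, y * u; 0, 0, 1 + z * u]
    !![1 + z * u, w * u, u; 0, 1, 0; 0, 0, 1]
    (by simpa [Matrix.det_fin_three] using h1) (by simpa [Matrix.det_fin_three] using h1)
    (memC_of π c (dvd_zero _) (dvd_zero _) (dvd_zero _))
    (memC_of π d (dvd_zero _) (dvd_zero _) (dvd_zero _)) (by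
      rw [mul_eq_mul_iff]
      intro i j
      fin_cases i <;> fin_cases j <;> simp [tForm] <;> ring)
  simpa [he.one₂, he.one₃] using this

theorem MatSupports.tForm_eq_one_of_dvd (he : CharPair π M N e₂ e₃) (hπ : Irreducible π)
    {y z₁ w p r : R} (hy : π ∣ y) (hz : π ∣ z₁)
    (h : MatSupports π e₂ e₃ c d (tForm y (y * z₁) w)) (hpr : y * p = w * r) :
    e₃ (1 + y * p) = 1 := by
  have h1 : IsUnit (1 + y * p) := isUnit_one_add hπ (hy.mul_right _)
  have h2 : IsUnit (1 + y * p - z₁ * r) := by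
    rw [sub_eq_add_neg]
    exact isUnit_add_of_dvd hπ h1 ((dvd_neg).2 (hz.mul_right _))
  have := h !![1, p, 0; 0, 1 + y * p - z₁ * r, r; 0, 0, 1 + y * p]
    !![1 + y * p, p, 0; 0, 1 + y * p - z₁ * r, r; 0, 0, 1]
    (by simpa [Matrix.det_fin_three] using h2.mul h1)
    (by simpa [Matrix.det_fin_three] using h1.mul h2)
    (memC_of π c (dvd_zero _) (dvd_zero _) (dvd_zero _))
    (memC_of π d (dvd_zero _) (dvd_zero _) (dvd_zero _)) (by
      rw [mul_eq_mul_iff]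
      intro i j
      fin_cases i <;> fin_cases j <;> simp [tForm] <;> grind)
  simpa [he.one₃, he.ne_zero₂] using this

/-- For `z = y w` the stabiliser of `tForm y z w` is larger than for the other lower unipotent
matrices; this is the source of the exception `x = 1`, `a₁ + a₂ = a₃`. -/
theorem MatSupports.tForm_mul_eq (he : CharPair π M N e₂ e₃) (hπ : Irreducible π)
    {y w : R} (hy : π ∣ y) (hw : π ∣ w)
    (h : MatSupports π e₂ e₃ c d (tForm y (y * w) w)) (u v : R) :
    e₂ (1 + w * v) = e₂ (1 + y * u) * e₃ (1 + w * v) := by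
  have h1 : IsUnit (1 + y * u) := isUnit_one_add hπ (hy.mul_right _)
  have h2 : IsUnit (1 + w * v) := isUnit_one_add hπ (hw.mul_right _)
  have := h !![1 + y * u, -u, 0; 0, 1 + w * v, -v; 0, 0, 1]
    !![1, -u, 0; 0, 1 + y * u, -v; 0, 0, 1 + w * v]
    (by simpa [Matrix.det_fin_three] using h1.mul h2)
    (by simpa [Matrix.det_fin_three] using h1.mul h2)
    (memC_of π c (dvd_zero _) (dvd_zero _) (dvd_zero _))
    (memC_of π d (dvd_zero _) (dvd_zero _) (dvd_zero _)) (by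
      rw [mul_eq_mul_iff]
      intro i j
      fin_cases i <;> fin_cases j <;> simp [tForm] <;> ring)
  simpa [he.one₃] using this

theorem MatSupports.le_of_s1Form (he : CharPair π M N e₂ e₃) (hπ : Irreducible π) {α β : ℕ}
    (hα : 1 ≤ α) (hβ : 1 ≤ β) (h : MatSupports π e₂ e₃ c d (s1Form (π ^ β) (π ^ α))) :
    N ≤ α ∧ N ≤ β := by
  have := h.s1Form_eq_one he hπ (dvd_pow_self π (by omega)) (dvd_pow_self π (by omega))
  exact ⟨he.le₃ _ hα fun v => by simpa using this v 0, he.le₃ _ hβ fun v => by simpa using this 0 v⟩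

theorem MatSupports.le_of_s2Form (he : CharPair π M N e₂ e₃) (hπ : Irreducible π) {α β : ℕ}
    (hα : 1 ≤ α) (hβ : 1 ≤ β) (h : MatSupports π e₂ e₃ c d (s2Form (π ^ β) (π ^ α))) :
    N ≤ α ∧ N ≤ β := by
  have := h.s2Form_eq_one he hπ (dvd_pow_self π (by omega)) (dvd_pow_self π (by omega))
  exact ⟨he.le₃ _ hα fun v => by simpa using this v 0, he.le₃ _ hβ fun v => by simpa using this 0 v⟩

theorem MatSupports.le_max_of_tForm (he : CharPair π M N e₂ e₃) (hπ : Irreducible π) {a : Triple}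
    (ha : a ∈ T1) (x : Rˣ)
    (h : MatSupports π e₂ e₃ c d (tForm (π ^ a 0) (x * π ^ a 2) (π ^ a 1))) :
    N ≤ max (a 0) (a 1) := by
  obtain ⟨h0, h1, h02, h12⟩ := ha
  refine he.le₃ _ (by omega) fun v => ?_
  by_cases hm : a 2 = max (a 0) (a 1)
  · have := h.tForm_eq_one he hπ ((dvd_pow_self π (by omega)).mul_left _) (x⁻¹ * v : R)
    rw [hm] at this
    rw [← this]
    congr 1
    linear_combination (-(π ^ max (a 0) (a 1)) * v) * x.mul_inv
  · have hz : (x : R) * π ^ a 2 = π ^ a 0 * (x * π ^ (a 2 - a 0)) := by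
      rw [mul_left_comm, ← pow_add, Nat.add_sub_cancel' h02]
    rw [hz] at h
    have key : ∀ {m k : ℕ}, m ≤ k → π ^ m * (π ^ (k - m) * v) = π ^ k * v := fun hk => by
      rw [← mul_assoc, ← pow_add, Nat.add_sub_cancel' hk]
    have := h.tForm_eq_one_of_dvd he hπ (p := π ^ (max (a 0) (a 1) - a 0) * v)
      (r := π ^ (max (a 0) (a 1) - a 1) * v) (dvd_pow_self π (by omega))
      ((dvd_pow_self π (by omega)).mul_left _)
      ((key (le_max_left _ _)).trans (key (le_max_right _ _)).symm)
    rwa [key (le_max_left _ _)] at this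

theorem MatSupports.le_of_tForm_one (he : CharPair π M N e₂ e₃) (hπ : Irreducible π) {a : Triple}
    (ha : a ∈ T1) (hsum : a 0 + a 1 = a 2)
    (h : MatSupports π e₂ e₃ c d (tForm (π ^ a 0) (π ^ a 2) (π ^ a 1))) :
    M ≤ a 0 ∧ N ≤ a 1 := by
  obtain ⟨h0, h1, h02, h12⟩ := ha
  rw [← hsum, pow_add] at h
  have := h.tForm_mul_eq he hπ (dvd_pow_self π (by omega)) (dvd_pow_self π (by omega))
  refine ⟨he.le₂ _ h0 fun u => ?_, he.le₂₃ _ h1 fun v => ?_⟩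
  · simpa [he.one₂, he.one₃] using (this u 0).symm
  · simpa [he.one₂] using this 0 v

end Support

/-! ### Distinctness of the double cosets for large `c` and `d` -/

section Distinct

/-- The value of `a(c,d)` for all sufficiently large `c` and `d`. -/
def stableExp (a : Triple) : ℕ := min (min (a 0) (a 1)) (min (a 2 - a 0) (a 2 - a 1))

theorem acd_le_stableExp (c d : Triple) {a : Triple} (ha : a ∈ T1) : acd c d a ≤ stableExp a := by
  obtain ⟨-, -, h0, h1⟩ := ha
  simp only [acd, stableExp, minEntry, diff]
  omega

theorem acd_const {a : Triple} (ha : a ∈ T1) {n : ℕ} (hn : 2 * a 2 ≤ n) :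
    acd (fun _ => n) (fun _ => n) a = stableExp a := by
  obtain ⟨-, -, h0, h1⟩ := ha
  simp only [acd, stableExp, minEntry, diff]
  omega

theorem acd'_const {a : Triple} (ha : a ∈ T1) (n : ℕ) :
    acd' (fun _ => n) (fun _ => n) a = n - a 2 := by
  obtain ⟨-, -, h0, h1⟩ := ha
  simp only [acd']
  omega

theorem const_mem_Tm {M N n : ℕ} (hM : M ≤ n) (hN : N ≤ n) : (fun _ => n) ∈ Tm M N := by
  refine ⟨⟨le_rfl, le_rfl, by simp⟩, fun i => ?_⟩
  fin_cases i <;> simpa [mTriple]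

variable {R : Type*} [CommRing R] {π : R}

/-- `x` and `y` have the same image in `X^a_{c,d}` for large `c` and `d`, in terms of the stable
value of `a(c,d)`; the number `a(c,d)'` grows without bound, so that it only matters for `x = 1`. -/
def SameXLimit (π : R) (a : Triple) (x y : R) : Prop :=
  if a 0 + a 1 = a 2 then
    x = y ∨ emultiplicity π (x - 1) + (stableExp a : ℕ∞) ≤ emultiplicity π (x - y)
  else π ^ stableExp a ∣ x - y

/-- If `x ≡ y` to the precision required by `SameXLimit`, then `t_{a,x}` and `t_{a,y}` are related
by upper triangular matrices; either the entry `(2,3)` or the entry `(1,2)` may be taken to be `0`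
in them. This is the case of a vanishing entry `(1,2)`. -/
theorem rel_tForm_of_right (c d : Triple) {a b e₁ e : ℕ} (he₁ : e = a + e₁) (x y : Rˣ)
    {v : R} (hv : (x : R) - y = (x * π ^ e₁ - π ^ b) * v) (hu : IsUnit (y - π ^ b * v)) :
    Rel π c d (tForm (π ^ a) (x * π ^ e) (π ^ b)) (tForm (π ^ a) (y * π ^ e) (π ^ b)) := by
  subst he₁
  refine ⟨!![x, 0, 0; 0, y - π ^ b * v, v; 0, 0, y], !![x, 0, 0; 0, y, v; 0, 0, y - π ^ b * v],
    ?_, ?_, memC_of π c (dvd_zero _) (dvd_zero _) (dvd_zero _),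
    memC_of π d (dvd_zero _) (dvd_zero _) (dvd_zero _), ?_⟩
  · simpa [Matrix.det_fin_three] using hu
  · simpa [Matrix.det_fin_three] using hu
  · rw [mul_eq_mul_iff, pow_add]
    intro i j
    fin_cases i <;> fin_cases j <;> simp [tForm] <;> grind

/-- The case of a vanishing entry `(2,3)`. -/
theorem rel_tForm_of_left (c d : Triple) {a b e₂ e : ℕ} (he₂ : e = b + e₂) (x y : Rˣ)
    {u : R} (hu : (x : R) - y = (π ^ a - y * π ^ e₂) * u) (hu' : IsUnit (x - π ^ a * u)) :
    Rel π c d (tForm (π ^ a) (x * π ^ e) (π ^ b)) (tForm (π ^ a) (y * π ^ e) (π ^ b)) := by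
  subst he₂
  refine ⟨!![x - π ^ a * u, u, 0; 0, x, 0; 0, 0, y], !![x, u, 0; 0, x - π ^ a * u, 0; 0, 0, y],
    ?_, ?_, memC_of π c (dvd_zero _) (dvd_zero _) (dvd_zero _),
    memC_of π d (dvd_zero _) (dvd_zero _) (dvd_zero _), ?_⟩
  · simpa [Matrix.det_fin_three] using hu'
  · simpa [Matrix.det_fin_three] using hu'
  · rw [mul_eq_mul_iff, pow_add]
    intro i j
    fin_cases i <;> fin_cases j <;> simp [tForm] <;> grind

variable [IsDomain R]

theorem eq_of_pow_dvd_sub (hπ : Irreducible π) {u v : R} (hu : IsUnit u) (hv : IsUnit v)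
    {m m' n : ℕ} (hm : m < n) (hm' : m' < n) (h : π ^ n ∣ u * π ^ m - v * π ^ m') : m = m' := by
  obtain ⟨u, rfl⟩ := hu
  obtain ⟨v, rfl⟩ := hv
  refine le_antisymm ?_ ?_
  · rw [← pow_dvd_unit_mul_pow_iff hπ v, ← dvd_sub_right ((dvd_refl _).mul_left _)]
    exact (pow_dvd_pow π hm.le).trans h
  · rw [← pow_dvd_unit_mul_pow_iff hπ u, ← dvd_sub_left ((dvd_refl _).mul_left _)]
    exact (pow_dvd_pow π hm'.le).trans h

theorem emultiplicity_unit_mul_pow (hπ : Irreducible π) (u : Rˣ) (n : ℕ) :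
    emultiplicity π (u * π ^ n) = n := by
  rw [emultiplicity_eq_coe, pow_dvd_unit_mul_pow_iff hπ, pow_dvd_unit_mul_pow_iff hπ]
  omega

variable [IsDiscreteValuationRing R]

/-- A matrix in `C_c`, for `c ≥ 1`, is upper triangular modulo the maximal ideal. -/
theorem MemC.isUnit_diag (hπ : Irreducible π) {c : Triple} (hc : ∀ i, 1 ≤ c i)
    {G : Matrix (Fin 3) (Fin 3) R} (hG : MemC π c G) (hdet : IsUnit G.det) :
    IsUnit (G 0 0) ∧ IsUnit (G 1 1) ∧ IsUnit (G 2 2) := by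
  obtain ⟨h1, h2, h3⟩ := hG.mono (c := fun _ => 1) hc
  simp only [pow_one] at h1 h2 h3
  have : IsUnit (G 0 0 * G 1 1 * G 2 2) := by
    have h := isUnit_add_of_dvd hπ hdet (r := G 0 0 * G 1 2 * G 2 1 + G 0 1 * G 2 2 * G 1 0
      - G 0 1 * G 1 2 * G 2 0 - G 0 2 * G 2 1 * G 1 0 + G 0 2 * G 1 1 * G 2 0)
      (dvd_add (dvd_sub (dvd_sub (dvd_add (h2.mul_left _) (h1.mul_left _)) (h3.mul_left _))
        (h1.mul_left _)) (h3.mul_left _))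
    rw [Matrix.det_fin_three] at h
    convert h using 1
    ring
  exact ⟨isUnit_of_mul_isUnit_left (isUnit_of_mul_isUnit_left this),
    isUnit_of_mul_isUnit_right (isUnit_of_mul_isUnit_left this), isUnit_of_mul_isUnit_right this⟩

variable {c d : Triple}

theorem not_rel_s1Form_tForm (hπ : Irreducible π) (hc : ∀ i, 1 ≤ c i) (hd : ∀ i, 1 ≤ d i)
    {z w y' z' w' : R} (hz : π ∣ z) (hy' : π ∣ y') :
    ¬ Rel π c d (s1Form z w) (tForm y' z' w') := by
  rintro ⟨G, H, hGu, -, hG, hH, h⟩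
  obtain ⟨-, hu, -⟩ := hG.isUnit_diag hπ hc hGu
  obtain ⟨k1, -, -⟩ := hH.mono (c := fun _ => 1) hd
  rw [mul_eq_mul_iff] at h
  have h' := h 1 0
  simp [s1Form, tForm] at h' k1
  refine (not_isUnit_iff_dvd hπ).2 ?_ hu
  rw [show G 1 1 = y' * H 0 0 + H 1 0 - G 1 2 * z by linear_combination h']
  exact dvd_sub (dvd_add (hy'.mul_right _) k1) (hz.mul_left _)

theorem not_rel_s2Form_tForm (hπ : Irreducible π) (hc : ∀ i, 1 ≤ c i) (hd : ∀ i, 1 ≤ d i)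
    {y z y' z' w' : R} (hz' : π ∣ z') (hw' : π ∣ w') :
    ¬ Rel π c d (s2Form y z) (tForm y' z' w') := by
  rintro ⟨G, H, hGu, -, hG, hH, h⟩
  obtain ⟨-, -, hu⟩ := hG.isUnit_diag hπ hc hGu
  obtain ⟨-, k2, -⟩ := hH.mono (c := fun _ => 1) hd
  rw [mul_eq_mul_iff] at h
  have h' := h 2 1
  simp [s2Form, tForm] at h' k2
  refine (not_isUnit_iff_dvd hπ).2 ?_ hu
  rw [h']
  exact dvd_add (dvd_add (hz'.mul_right _) (hw'.mul_right _)) k2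

theorem not_rel_s1Form_s2Form (hπ : Irreducible π) (hc : ∀ i, 1 ≤ c i) (hd : ∀ i, 1 ≤ d i)
    {z w y' z' : R} (hz : π ∣ z) (hy' : π ∣ y') :
    ¬ Rel π c d (s1Form z w) (s2Form y' z') := by
  rintro ⟨G, H, hGu, -, hG, hH, h⟩
  obtain ⟨-, hu, -⟩ := hG.isUnit_diag hπ hc hGu
  obtain ⟨-, -, k3⟩ := hH.mono (c := fun _ => 1) hd
  rw [mul_eq_mul_iff] at h
  have h' := h 1 0
  simp [s1Form, s2Form] at h' k3
  refine (not_isUnit_iff_dvd hπ).2 ?_ hu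
  rw [show G 1 1 = y' * H 0 0 + H 2 0 - G 1 2 * z by linear_combination h']
  exact dvd_sub (dvd_add (hy'.mul_right _) k3) (hz.mul_left _)

theorem eq_of_rel_s1Form (hπ : Irreducible π) {α β α' β' n : ℕ} (hα : α < n) (hβ : β < n)
    (hα' : α' < n) (hβ' : β' < n) (hβ1 : 1 ≤ β') (hc : ∀ i, n ≤ c i) (hd : ∀ i, n ≤ d i)
    (h : Rel π c d (s1Form (π ^ β) (π ^ α)) (s1Form (π ^ β') (π ^ α'))) : α = α' ∧ β = β' := by
  obtain ⟨G, H, hGu, hHu, hG, hH, h⟩ := h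
  obtain ⟨-, -, hu⟩ := hG.isUnit_diag hπ (fun i => by have := hc i; omega) hGu
  obtain ⟨hv, hv', -⟩ := hH.isUnit_diag hπ (fun i => by have := hd i; omega) hHu
  obtain ⟨g1, g2, g3⟩ := hG.mono (c := fun _ => n) hc
  obtain ⟨k1, k2, k3⟩ := hH.mono (c := fun _ => n) hd
  rw [mul_eq_mul_iff] at h
  simp [Fin.forall_fin_succ, s1Form] at h
  obtain ⟨-, ⟨-, e5, -⟩, e7, e8, -⟩ := h
  constructor
  · refine eq_of_pow_dvd_sub hπ (u := G 2 2 + π ^ β' * -G 1 2)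
      (isUnit_add_of_dvd hπ hu ((dvd_pow_self π (by omega)).mul_right _)) hv' hα hα' ?_
    rw [show (G 2 2 + π ^ β' * -G 1 2) * π ^ α - H 1 1 * π ^ α' =
      H 2 1 + π ^ β' * G 1 0 - G 2 0 by linear_combination e8 - π ^ β' * e5]
    exact dvd_sub (dvd_add k2 (g1.mul_left _)) g3
  · refine eq_of_pow_dvd_sub hπ hu hv hβ hβ' ?_
    rw [show G 2 2 * π ^ β - H 0 0 * π ^ β' = π ^ α' * H 1 0 + H 2 0 - G 2 1 by
      linear_combination e7]
    exact dvd_sub (dvd_add (k1.mul_left _) k3) g2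

theorem eq_of_rel_s2Form (hπ : Irreducible π) {α β α' β' n : ℕ} (hα : α < n) (hβ : β < n)
    (hα' : α' < n) (hβ' : β' < n) (hα1 : 1 ≤ α) (hc : ∀ i, n ≤ c i) (hd : ∀ i, n ≤ d i)
    (h : Rel π c d (s2Form (π ^ β) (π ^ α)) (s2Form (π ^ β') (π ^ α'))) : α = α' ∧ β = β' := by
  obtain ⟨G, H, hGu, hHu, hG, hH, h⟩ := h
  obtain ⟨-, hu', hu⟩ := hG.isUnit_diag hπ (fun i => by have := hc i; omega) hGu
  obtain ⟨hv, -, -⟩ := hH.isUnit_diag hπ (fun i => by have := hd i; omega) hHu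
  obtain ⟨g1, g2, g3⟩ := hG.mono (c := fun _ => n) hc
  obtain ⟨k1, k2, k3⟩ := hH.mono (c := fun _ => n) hd
  rw [mul_eq_mul_iff] at h
  simp [Fin.forall_fin_succ, s2Form] at h
  obtain ⟨-, ⟨e4, e5, -⟩, e7, -, -⟩ := h
  constructor
  · refine eq_of_pow_dvd_sub hπ hu hv hα hα' ?_
    rw [show G 2 2 * π ^ α - H 0 0 * π ^ α' = H 1 0 - G 2 0 - G 2 1 * π ^ β by
      linear_combination e7]
    exact dvd_sub (dvd_sub k1 g3) (g2.mul_right _)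
  · refine eq_of_pow_dvd_sub hπ hu' (v := H 0 0 + π ^ α * -H 0 1)
      (isUnit_add_of_dvd hπ hv ((dvd_pow_self π (by omega)).mul_right _)) hβ hβ' ?_
    rw [show G 1 1 * π ^ β - (H 0 0 + π ^ α * -H 0 1) * π ^ β' =
      H 2 0 - G 1 0 - π ^ α * H 2 1 by linear_combination e4 - π ^ α * e5]
    exact dvd_sub (dvd_sub k3 g1) (k2.mul_left _)

theorem eq_of_rel_tForm (hπ : Irreducible π) {a b : Triple} (ha : a ∈ T1) (hb : b ∈ T1)
    {x y : R} (hx : IsUnit x) (hy : IsUnit y) {n : ℕ} (han : a 2 < n) (hbn : b 2 < n)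
    (hc : ∀ i, n ≤ c i) (hd : ∀ i, n ≤ d i)
    (h : Rel π c d (tForm (π ^ a 0) (x * π ^ a 2) (π ^ a 1))
      (tForm (π ^ b 0) (y * π ^ b 2) (π ^ b 1))) : a = b := by
  obtain ⟨ha0, ha1, ha02, ha12⟩ := ha
  obtain ⟨hb0, hb1, hb02, hb12⟩ := hb
  obtain ⟨G, H, hGu, hHu, hG, hH, h⟩ := h
  obtain ⟨-, hu', hu⟩ := hG.isUnit_diag hπ (fun i => by have := hc i; omega) hGu
  obtain ⟨hv, hv', -⟩ := hH.isUnit_diag hπ (fun i => by have := hd i; omega) hHu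
  obtain ⟨g1, g2, g3⟩ := hG.mono (c := fun _ => n) hc
  obtain ⟨k1, k2, k3⟩ := hH.mono (c := fun _ => n) hd
  rw [mul_eq_mul_iff] at h
  simp [Fin.forall_fin_succ, tForm] at h
  obtain ⟨-, ⟨e4, -, -⟩, e7, e8, -⟩ := h
  have h2 : a 2 = b 2 := by
    refine eq_of_pow_dvd_sub hπ (hx.mul hu) (hy.mul hv) han hbn ?_
    rw [show x * G 2 2 * π ^ a 2 - y * H 0 0 * π ^ b 2 =
      π ^ b 1 * H 1 0 + H 2 0 - G 2 0 - G 2 1 * π ^ a 0 by linear_combination e7]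
    exact dvd_sub (dvd_sub (dvd_add (k1.mul_left _) k3) g3) (g2.mul_right _)
  -- Modulo `π ^ a₃` the entries `(2,1)` and `(3,2)` are compared in the same way.
  have key : ∀ {u v : R} {m m' : ℕ}, IsUnit u → IsUnit v → m ≤ a 2 → m' ≤ a 2 →
      π ^ a 2 ∣ u * π ^ m - v * π ^ m' → m = m' := by
    intro u v m m' hu hv hm hm' h
    rcases hm.lt_or_eq with hm | rfl <;> rcases hm'.lt_or_eq with hm' | rfl
    · exact eq_of_pow_dvd_sub hπ hu hv hm hm' h
    · obtain ⟨u, rfl⟩ := hu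
      exact le_antisymm hm.le ((pow_dvd_unit_mul_pow_iff hπ u).1
        ((dvd_sub_left ((dvd_refl _).mul_left _)).1 h))
    · obtain ⟨v, rfl⟩ := hv
      exact le_antisymm ((pow_dvd_unit_mul_pow_iff hπ v).1
        ((dvd_sub_right ((dvd_refl _).mul_left _)).1 h)) hm'.le
    · rfl
  have hn : π ^ a 2 ∣ π ^ n := pow_dvd_pow π han.le
  have h0 : a 0 = b 0 := by
    refine key hu' hv ha02 (h2 ▸ hb02) ?_
    rw [show G 1 1 * π ^ a 0 - H 0 0 * π ^ b 0 = H 1 0 - G 1 0 - π ^ a 2 * (x * G 1 2) by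
      linear_combination e4]
    exact dvd_sub (hn.trans (dvd_sub k1 g1)) (dvd_mul_right _ _)
  have h1 : a 1 = b 1 := by
    refine key hu hv' ha12 (h2 ▸ hb12) ?_
    rw [show G 2 2 * π ^ a 1 - H 1 1 * π ^ b 1 = H 2 1 - G 2 1 + π ^ a 2 * (y * H 0 1) by
      rw [h2]; linear_combination e8]
    exact dvd_add (hn.trans (dvd_sub k2 g2)) (dvd_mul_right _ _)
  ext i
  fin_cases i <;> assumption

/-- The congruence between the parameters `x` and `y` of two related matrices `t_{a,x}` and
`t_{a,y}`. -/
theorem exists_congr_of_rel_tForm (hπ : Irreducible π) {a : Triple} (ha : a ∈ T1) (x y : R)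
    {k n : ℕ} (hk : 1 ≤ k) (hn : a 2 + k ≤ n) (hc : ∀ i, n ≤ c i) (hd : ∀ i, n ≤ d i)
    (h : Rel π c d (tForm (π ^ a 0) (x * π ^ a 2) (π ^ a 1))
      (tForm (π ^ a 0) (y * π ^ a 2) (π ^ a 1))) :
    ∃ g p r : R, IsUnit g ∧ π ^ k ∣ (x - y) * g -
      y * ((x * π ^ (a 2 - a 0) - π ^ a 1) * p - (y * π ^ (a 2 - a 1) - π ^ a 0) * r) := by
  obtain ⟨-, -, h02, h12⟩ := ha
  obtain ⟨G, H, hGu, -, hG, hH, h⟩ := h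
  obtain ⟨-, -, hu⟩ := hG.isUnit_diag hπ (fun i => by have := hc i; omega) hGu
  obtain ⟨g1, g2, g3⟩ := hG.mono (c := fun _ => n) hc
  obtain ⟨k1, k2, k3⟩ := hH.mono (c := fun _ => n) hd
  rw [mul_eq_mul_iff] at h
  simp [Fin.forall_fin_succ, tForm] at h
  obtain ⟨-, ⟨e4, e5, -⟩, e7, e8, -⟩ := h
  have p0 : π ^ a 2 = π ^ a 0 * π ^ (a 2 - a 0) := by rw [← pow_add, Nat.add_sub_cancel' h02]
  have p1 : π ^ a 2 = π ^ a 1 * π ^ (a 2 - a 1) := by rw [← pow_add, Nat.add_sub_cancel' h12]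
  refine ⟨G 2 2, G 1 2, H 0 1, hu, ?_⟩
  have f1 : π ^ k ∣ x * G 2 2 - y * H 0 0 := by
    refine dvd_of_pow_dvd_pow_mul (m := a 2) hπ hn ?_
    rw [show π ^ a 2 * (x * G 2 2 - y * H 0 0) =
      π ^ a 1 * H 1 0 + H 2 0 - G 2 0 - G 2 1 * π ^ a 0 by linear_combination e7]
    exact dvd_sub (dvd_sub (dvd_add (k1.mul_left _) k3) g3) (g2.mul_right _)
  have f2 : π ^ k ∣ G 1 1 + x * π ^ (a 2 - a 0) * G 1 2 - H 0 0 := by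
    refine dvd_of_pow_dvd_pow_mul (m := a 0) (n := n) hπ (by omega) ?_
    rw [show π ^ a 0 * (G 1 1 + x * π ^ (a 2 - a 0) * G 1 2 - H 0 0) = H 1 0 - G 1 0 by
      linear_combination e4 - x * G 1 2 * p0]
    exact dvd_sub k1 g1
  have f3 : π ^ k ∣ G 2 2 - y * π ^ (a 2 - a 1) * H 0 1 - H 1 1 := by
    refine dvd_of_pow_dvd_pow_mul (m := a 1) (n := n) hπ (by omega) ?_
    rw [show π ^ a 1 * (G 2 2 - y * π ^ (a 2 - a 1) * H 0 1 - H 1 1) = H 2 1 - G 2 1 by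
      linear_combination e8 + y * H 0 1 * p1]
    exact dvd_sub k2 g2
  rw [show (x - y) * G 2 2 - y * ((x * π ^ (a 2 - a 0) - π ^ a 1) * G 1 2 -
      (y * π ^ (a 2 - a 1) - π ^ a 0) * H 0 1) = (x * G 2 2 - y * H 0 0) -
      y * (G 1 1 + x * π ^ (a 2 - a 0) * G 1 2 - H 0 0) -
      y * (G 2 2 - y * π ^ (a 2 - a 1) * H 0 1 - H 1 1) by linear_combination y * e5]
  exact dvd_sub (dvd_sub f1 (f2.mul_left _)) (f3.mul_left _)

theorem exists_not_pow_dvd (hπ : Irreducible π) {r : R} (hr : r ≠ 0) :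
    ∃ k, 1 ≤ k ∧ ¬ π ^ k ∣ r := by
  obtain ⟨n, u, rfl⟩ := IsDiscreteValuationRing.eq_unit_mul_pow_irreducible hr hπ
  refine ⟨n + 1, by omega, fun h => ?_⟩
  rw [pow_dvd_unit_mul_pow_iff hπ] at h
  omega

theorem sameXLimit_of_rel (hπ : Irreducible π) {a : Triple} (ha : a ∈ T1) (x y : R) :
    ∃ n, ∀ c d : Triple, (∀ i, n ≤ c i) → (∀ i, n ≤ d i) →
      Rel π c d (tForm (π ^ a 0) (x * π ^ a 2) (π ^ a 1))
        (tForm (π ^ a 0) (y * π ^ a 2) (π ^ a 1)) → SameXLimit π a x y := by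
  unfold SameXLimit
  have hA0 : stableExp a ≤ a 0 := by simp only [stableExp]; omega
  have hA1 : stableExp a ≤ a 1 := by simp only [stableExp]; omega
  split_ifs with hsum
  · by_cases hxy : x = y
    · exact ⟨0, fun _ _ _ _ _ => .inl hxy⟩
    obtain ⟨k, hk, hkd⟩ := exists_not_pow_dvd hπ (sub_ne_zero.2 hxy)
    refine ⟨a 2 + k, fun c d hc hd h => .inr ?_⟩
    obtain ⟨g, p, r, hg, hdvd⟩ := exists_congr_of_rel_tForm hπ ha x y hk le_rfl hc hd h
    rw [show a 2 - a 0 = a 1 by omega, show a 2 - a 1 = a 0 by omega] at hdvd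
    obtain ⟨s, hs⟩ : IsUnit (g + π ^ a 0 * -(y * r)) :=
      isUnit_add_of_dvd hπ hg ((dvd_pow_self π (by have := ha.1; omega)).mul_right _)
    have key : π ^ k ∣ s * (x - y) - (x - 1) * (y * (π ^ a 1 * p - π ^ a 0 * r)) := by
      rw [hs]
      convert hdvd using 1
      ring
    have hA : π ^ stableExp a ∣ y * (π ^ a 1 * p - π ^ a 0 * r) :=
      (dvd_sub ((pow_dvd_pow π hA1).mul_right _) ((pow_dvd_pow π hA0).mul_right _)).mul_left _
    have hx1 : x - 1 ≠ 0 := by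
      intro h1
      rw [h1, zero_mul, sub_zero, Units.dvd_mul_left] at key
      exact hkd key
    obtain ⟨j, u, hj⟩ := IsDiscreteValuationRing.eq_unit_mul_pow_irreducible hx1 hπ
    have hjA : π ^ (j + stableExp a) ∣ (x - 1) * (y * (π ^ a 1 * p - π ^ a 0 * r)) := by
      rw [pow_add]
      exact mul_dvd_mul (hj ▸ dvd_mul_left _ _) hA
    rw [hj, emultiplicity_unit_mul_pow hπ, ← Nat.cast_add, ← pow_dvd_iff_le_emultiplicity]
    rcases le_total k (j + stableExp a) with hle | hle
    · exfalso
      rw [dvd_sub_left ((pow_dvd_pow π hle).trans hjA), Units.dvd_mul_left] at key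
      exact hkd key
    · rw [← Units.dvd_mul_left (u := s), ← dvd_sub_left hjA]
      exact (pow_dvd_pow π hle).trans key
  · have hA2 : stableExp a ≤ a 2 - a 0 := by simp only [stableExp]; omega
    have hA3 : stableExp a ≤ a 2 - a 1 := by simp only [stableExp]; omega
    refine ⟨a 2 + (stableExp a + 1), fun c d hc hd h => ?_⟩
    obtain ⟨g, p, r, ⟨g, rfl⟩, hdvd⟩ :=
      exists_congr_of_rel_tForm hπ ha x y (by omega) le_rfl hc hd h
    replace hdvd := (pow_dvd_pow π (Nat.le_succ _)).trans hdvd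
    rwa [dvd_sub_left, Units.dvd_mul_right] at hdvd
    refine (dvd_sub ((dvd_sub ?_ (pow_dvd_pow π hA1)).mul_right _)
      ((dvd_sub ?_ (pow_dvd_pow π hA0)).mul_right _)).mul_left _
    · exact (pow_dvd_pow π hA2).mul_left _
    · exact (pow_dvd_pow π hA3).mul_left _

/-- A difference of two terms of different valuations. -/
theorem exists_unit_sub_pow (hπ : Irreducible π) (u v : Rˣ) {m n : ℕ} (h : m ≠ n) :
    ∃ s : Rˣ, u * π ^ m - v * π ^ n = s * π ^ min m n := by
  rcases h.lt_or_gt with h | h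
  · obtain ⟨s, hs⟩ := exists_unit_add_pow hπ (-v) u h
    refine ⟨s, ?_⟩
    rw [min_eq_left h.le, ← hs]
    push_cast; ring
  · obtain ⟨s, hs⟩ := exists_unit_add_pow hπ u (-v) h
    refine ⟨s, ?_⟩
    rw [min_eq_right h.le, ← hs]
    push_cast; ring

theorem rel_of_sameXLimit (hπ : Irreducible π) {a : Triple} (ha : a ∈ T1) (x y : Rˣ)
    (h : SameXLimit π a (x : R) y) (c d : Triple) :
    Rel π c d (tForm (π ^ a 0) (x * π ^ a 2) (π ^ a 1))
      (tForm (π ^ a 0) (y * π ^ a 2) (π ^ a 1)) := by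
  obtain ⟨h0, h1, h02, h12⟩ := ha
  have hleft : (π ^ a 0 - y * π ^ (a 2 - a 1)) ∣ (x : R) - y →
      Rel π c d (tForm (π ^ a 0) (x * π ^ a 2) (π ^ a 1))
        (tForm (π ^ a 0) (y * π ^ a 2) (π ^ a 1)) := by
    rintro ⟨u, hu⟩
    exact rel_tForm_of_left c d (Nat.add_sub_cancel' h12).symm x y hu (by
      rw [sub_eq_add_neg]
      exact isUnit_add_of_dvd hπ x.isUnit ((dvd_neg).2 ((dvd_pow_self π (by omega)).mul_right _)))
  have hright : (x * π ^ (a 2 - a 0) - π ^ a 1) ∣ (x : R) - y →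
      Rel π c d (tForm (π ^ a 0) (x * π ^ a 2) (π ^ a 1))
        (tForm (π ^ a 0) (y * π ^ a 2) (π ^ a 1)) := by
    rintro ⟨v, hv⟩
    exact rel_tForm_of_right c d (Nat.add_sub_cancel' h02).symm x y hv (by
      rw [sub_eq_add_neg]
      exact isUnit_add_of_dvd hπ y.isUnit ((dvd_neg).2 ((dvd_pow_self π (by omega)).mul_right _)))
  unfold SameXLimit at h
  split_ifs at h with hsum
  · have e0 : a 2 - a 0 = a 1 := by omega
    have e1 : a 2 - a 1 = a 0 := by omega
    rcases h with h | h
    · exact hright (by simp [h])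
    by_cases hxy : (x : R) = y
    · exact hright (by simp [hxy])
    have hx1 : (x : R) - 1 ≠ 0 := by
      intro h1
      rw [h1, emultiplicity_zero, top_add, top_le_iff] at h
      obtain ⟨k, -, hk⟩ := exists_not_pow_dvd hπ (sub_ne_zero.2 hxy)
      exact hk (pow_dvd_of_le_emultiplicity (h ▸ le_top))
    obtain ⟨j, u, hj⟩ := IsDiscreteValuationRing.eq_unit_mul_pow_irreducible hx1 hπ
    rw [hj, emultiplicity_unit_mul_pow hπ, ← Nat.cast_add, ← pow_dvd_iff_le_emultiplicity] at h
    rcases le_total (a 1) (a 0) with hle | hle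
    · have hA : stableExp a = a 1 := by simp only [stableExp]; omega
      refine hright ?_
      rw [e0, show (x : R) * π ^ a 1 - π ^ a 1 = u * π ^ (j + a 1) by
        rw [pow_add]; linear_combination π ^ a 1 * hj, Units.mul_left_dvd]
      rwa [hA] at h
    · have hA : stableExp a = a 0 := by simp only [stableExp]; omega
      rw [hA] at h
      refine hleft ?_
      obtain ⟨r, hr⟩ := h
      obtain ⟨s, hs⟩ := isUnit_add_of_dvd hπ (-u).isUnit (r := π ^ a 0 * r)
        ((dvd_pow_self π (by omega)).mul_right _)
      rw [e1, show π ^ a 0 - (y : R) * π ^ a 0 = s * π ^ (j + a 0) by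
        rw [hs]; push_cast; rw [pow_add] at hr ⊢; linear_combination π ^ a 0 * (hr - hj),
        Units.mul_left_dvd, hr]
      exact dvd_mul_right _ _
  · obtain ⟨s, hs⟩ := exists_unit_sub_pow hπ x 1 (m := a 2 - a 0) (n := a 1) (by omega)
    obtain ⟨t, ht⟩ := exists_unit_sub_pow hπ 1 y (m := a 0) (n := a 2 - a 1) (by omega)
    rw [Units.val_one, one_mul] at hs ht
    by_cases hm : min (a 2 - a 0) (a 1) ≤ min (a 0) (a 2 - a 1)
    · refine hright ?_
      rw [hs, Units.mul_left_dvd]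
      exact (pow_dvd_pow π (by simp only [stableExp]; omega)).trans h
    · refine hleft ?_
      rw [ht, Units.mul_left_dvd]
      exact (pow_dvd_pow π (by simp only [stableExp]; omega)).trans h

theorem sameXLarge_iff (hπ : Irreducible π) (M N : ℕ) {a : Triple} (ha : a ∈ T1) (x y : R) :
    SameXLarge π M N a x y ↔ SameXLimit π a x y := by
  constructor
  · rintro ⟨e, -, h⟩
    have hlarge : ∀ n, e 0 + e 1 + e 2 + M + N ≤ n →
        SameX π (fun _ => n) (fun _ => n) a x y := by
      intro n hn
      have hmem : (fun _ => n) ∈ Tm M N := const_mem_Tm (by omega) (by omega)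
      have hle : e ≤ fun _ => n := by intro i; fin_cases i <;> simp <;> omega
      exact h _ hmem _ hmem hle hle
    unfold SameXLimit
    split_ifs with hsum
    · by_cases hxy : x = y
      · exact .inl hxy
      obtain ⟨k, -, hk⟩ := exists_not_pow_dvd hπ (sub_ne_zero.2 hxy)
      have := hlarge (e 0 + e 1 + e 2 + M + N + 2 * a 2 + k) (by omega)
      rw [SameX, if_pos hsum, acd_const ha (by omega), acd'_const ha, min_le_iff] at this
      refine .inr (this.resolve_right fun h' => hk ?_)
      exact (pow_dvd_pow π (by omega)).trans (pow_dvd_of_le_emultiplicity h')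
    · have := hlarge (e 0 + e 1 + e 2 + M + N + 2 * a 2) (by omega)
      rw [SameX, if_neg hsum, acd_const ha (by omega)] at this
      exact pow_dvd_of_le_emultiplicity this
  · intro h
    refine ⟨fun _ => M + N, const_mem_Tm (by omega) (by omega), fun c _ d _ _ _ => ?_⟩
    have hle : (acd c d a : ℕ∞) ≤ stableExp a := by exact_mod_cast acd_le_stableExp c d ha
    unfold SameXLimit at h
    unfold SameX
    split_ifs at h ⊢ with hsum
    · rcases h with rfl | h
      · simp
      · exact (min_le_left _ _).trans ((add_le_add_right hle _).trans h)
    · exact hle.trans (le_emultiplicity_of_pow_dvd h)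

end Distinct

/-! ### The distinguished representatives -/

section Representatives

variable {R : Type*} [CommRing R] {π : R}

theorem under_mem_T {c : Triple} (hc : c ∈ T) : under c ∈ T := by
  obtain ⟨h1, h2, h3⟩ := hc
  simp only [T, under, Set.mem_ofPred_eq]
  omega

theorem le_under (c : Triple) : c ≤ under c := fun _ => le_max_left _ _

theorem one_le_of_mem_Tm {M N : ℕ} (hN : 0 < N) {c : Triple} (hc : c ∈ Tm M N) :
    1 ≤ c 1 ∧ 1 ≤ c 2 := by
  have h1 : N ≤ c 1 := hc.2 1
  have h2 : N ≤ c 2 := hc.2 2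
  omega

theorem Rel.refl (π : R) (c d : Triple) (A : Matrix (Fin 3) (Fin 3) R) : Rel π c d A A :=
  ⟨1, 1, by simp, by simp, by simp [MemC], by simp [MemC], by simp⟩

theorem one_mem_Wcd (c d : Triple) : Weyl.one ∈ Wcd c d := by
  simp only [Wcd, Set.mem_ofPred_eq]
  split_ifs <;> simp

theorem mem_Wcd_of_pos {c d : Triple} (hc : c ∈ T) (hd : d ∈ T) (hc0 : 0 < c 0) (hc1 : 0 < c 1)
    (hd0 : 0 < d 0) (hd1 : 0 < d 1) (w : Weyl) : w ∈ Wcd c d := by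
  have h1 := hc.1
  have h2 := hd.1
  simp only [Wcd, Set.mem_ofPred_eq, Fin.forall_fin_succ]
  rw [if_pos]
  · trivial
  · simp
    omega

theorem s2_mem_Wcd {c d : Triple} (hc : c ∈ T) (hd : d ∈ T) (hc1 : 0 < c 1) (hd1 : 0 < d 1)
    (h : 0 < c 0 + d 0) : Weyl.s2 ∈ Wcd c d := by
  by_cases h0 : 0 < c 0 ∧ 0 < d 0
  · exact mem_Wcd_of_pos hc hd h0.1 hc1 h0.2 hd1 _
  have hz : c 0 * d 0 = 0 := by
    rw [Nat.mul_eq_zero]; omega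
  simp only [Wcd, Set.mem_ofPred_eq]
  rw [if_neg (fun h' => h0 ⟨h'.1 0, h'.2 0⟩), if_neg (by simp [hz]),
    if_pos ⟨hz, Nat.mul_pos h (Nat.mul_pos hc1 hd1)⟩]
  simp

theorem mem_T1_of_mem_Tcd {c d a : Triple} (hc1 : 1 ≤ c 1) (hd1 : 1 ≤ d 1) (ha : a ∈ Tcd c d) :
    a ∈ T1 := by
  simp only [Tcd, Set.mem_ofPred_eq] at ha
  split_ifs at ha with h1 h2 h3
  · exfalso
    rcases h1 with rfl | rfl <;> simp at hc1 hd1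
  · obtain ⟨n, hn, -, rfl⟩ := ha
    simpa [T1] using hn
  · omega
  · exact ha.1

variable [IsDomain R] [IsDiscreteValuationRing R]

theorem exists_rel_tMat (hπ : Irreducible π) (h2 : IsUnit (2 : R)) {c d : Triple} (hc : c ∈ T)
    (hd : d ∈ T) (hc1 : 1 ≤ c 1) (hd1 : 1 ≤ d 1) {y z w : R} (hy : π ∣ y) (hz : π ∣ z)
    (hw : π ∣ w) :
    ∃ s ∈ Rcd π c d .one, Rel π c d (tForm y z w) s.val := by
  obtain ⟨a, ha, hac, had, ha2, x, hr⟩ := exists_rel_tForm hπ h2 (under_mem_T hc) (under_mem_T hd)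
    (le_max_right _ _) (le_max_right _ _) (le_max_right _ _) (le_max_right _ _) hy hz hw
    (Rel.refl π _ _ (tForm y z w))
  replace hr := hr.mono (le_under c) (le_under d)
  have hcn : c ≠ 0 := by rintro rfl; simp at hc1
  have hdn : d ≠ 0 := by rintro rfl; simp at hd1
  by_cases h0 : c 0 = 0 ∧ d 0 = 0
  · have hmem : ∀ n, 1 ≤ n → n ≤ min (c 1) (d 1) → ![1, n, n] ∈ Tcd c d := by
      intro n hn hn'
      simp only [Tcd, Set.mem_ofPred_eq]
      rw [if_neg (by tauto), if_pos ⟨Nat.mul_pos hc1 hd1, h0⟩]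
      exact ⟨n, hn, hn', rfl⟩
    obtain ⟨h10, h11, h02, h12⟩ := ha
    have ha0 : a 0 = 1 := by
      have := hac 0
      simp only [under] at this
      omega
    have ha1 : a 1 ≤ min (c 1) (d 1) := by
      have h := hac 1
      have h' := had 1
      simp only [under] at h h'
      omega
    simp only [under] at ha2
    by_cases ha21 : a 2 = a 1
    · refine ⟨_, ⟨_, hmem (a 1) h11 ha1, x, rfl⟩, ?_⟩
      rw [ha0, ha21] at hr
      exact hr
    · -- Here `a = (1, a₂, a₂ + 1)`, and adding `π ^ a₂` to the entry `(3,1)` leads to `(1, a₂, a₂)`.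
      obtain ⟨x', hx'⟩ := isUnit_one_add hπ (dvd_mul_left π (x : R))
      refine ⟨_, ⟨_, hmem (a 1) h11 ha1, x', rfl⟩, hr.trans hc hd ?_⟩
      refine rel_tForm_lower (p := -1) (q := 0) (r := 0) (p' := -1) (q' := 0) (r' := 0)
        (by simp [h0.1]) (dvd_zero _) (dvd_zero _) (by simp [h0.2]) (dvd_zero _) (dvd_zero _)
        ?_ ?_ ?_
      · simp [ha0]; ring
      · simp
      · rw [hx', show a 2 = a 1 + 1 by omega]
        simp
        ring
  · refine ⟨_, ⟨a, ?_, x, rfl⟩, hr⟩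
    simp only [Tcd, Set.mem_ofPred_eq]
    rw [if_neg (by tauto), if_neg (by tauto), if_neg (by omega)]
    exact ⟨ha, hac, had, ha2⟩

/-- Every double coset of `C_c` and `C_d` contains a distinguished representative or a matrix of
one of the three shapes whose diagonal stabilisers forbid intertwining operators. -/
theorem exists_rel_mem_Rcd (hπ : Irreducible π) (h2 : IsUnit (2 : R)) {c d : Triple} (hc : c ∈ T)
    (hd : d ∈ T) (hc1 : 1 ≤ c 1) (hd1 : 1 ≤ d 1) {A : Matrix (Fin 3) (Fin 3) R}
    (hA : IsUnit A.det) :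
    Rel π c d A w0Form ∨ (∃ w, Rel π c d A (s2s1Form w)) ∨ (∃ z, Rel π c d A (s1s2Form z)) ∨
      ∃ w ∈ Wcd c d, ∃ s ∈ Rcd π c d w, Rel π c d A s.val := by
  have hT : ∀ {y z w : R}, π ∣ y → π ∣ z → π ∣ w → Rel π c d A (tForm y z w) →
      ∃ w ∈ Wcd c d, ∃ s ∈ Rcd π c d w, Rel π c d A s.val := by
    intro y z w hy hz hw hr
    obtain ⟨s, hs, hr'⟩ := exists_rel_tMat hπ h2 hc hd hc1 hd1 hy hz hw
    exact ⟨_, one_mem_Wcd c d, s, hs, hr.trans hc hd hr'⟩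
  have hc2 := hc.2.1
  have hd2 := hd.2.1
  have mono : ∀ {B : Matrix (Fin 3) (Fin 3) R}, Rel π (under c) (under d) A B → Rel π c d A B :=
    fun h => h.mono (le_under c) (le_under d)
  rcases rel_bruhat π (under_mem_T hc) (under_mem_T hd) hA with
    h | ⟨w, h⟩ | ⟨z, h⟩ | ⟨z, w, hz, hw, h⟩ | ⟨y, z, hy, hz, h⟩ | ⟨y, z, w, hy, hz, hw, h⟩
  · exact .inl (mono h)
  · exact .inr (.inl ⟨w, mono h⟩)
  · exact .inr (.inr (.inl ⟨z, mono h⟩))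
  · rw [not_isUnit_iff_dvd hπ] at hz hw
    refine .inr (.inr (.inr ?_))
    rcases Nat.eq_zero_or_pos (c 0) with hc0 | hc0
    · refine hT (dvd_zero _) hz hw ((mono h).trans hc hd ?_)
      refine ⟨!![0, 1, 0; 1, 0, 0; 0, 0, 1], 1, by simp [Matrix.det_fin_three], by simp,
        memC_of π c (by simp [hc0]) (dvd_zero _) (dvd_zero _), by simp [MemC], ?_⟩
      rw [mul_one]
      ext i j
      fin_cases i <;> fin_cases j <;> simp [s1Form, tForm, Matrix.mul_apply, Fin.sum_univ_three]
    rcases Nat.eq_zero_or_pos (d 0) with hd0 | hd0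
    · refine hT (dvd_zero _) hw hz ((mono h).trans hc hd ?_)
      refine ⟨1, !![0, 1, 0; 1, 0, 0; 0, 0, 1], by simp, by simp [Matrix.det_fin_three],
        by simp [MemC], memC_of π d (by simp [hd0]) (dvd_zero _) (dvd_zero _), ?_⟩
      rw [one_mul]
      ext i j
      fin_cases i <;> fin_cases j <;> simp [s1Form, tForm, Matrix.mul_apply, Fin.sum_univ_three]
    obtain ⟨α, β, hα1, hα, hβ1, hβ, h1, h2, hr⟩ := exists_rel_s1Form hπ (under_mem_T hc)
      (under_mem_T hd) (le_max_right _ _) (le_max_right _ _) hz hw h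
    simp only [under] at hα hβ h1 h2
    refine ⟨.s1, mem_Wcd_of_pos hc hd hc0 hc1 hd0 hd1 _, s1Mat π α β,
      ⟨α, β, hα1, ?_, hβ1, ?_, ?_, ?_, rfl⟩, mono hr⟩
    all_goals first | omega | (simp only [under]; omega)
  · rw [not_isUnit_iff_dvd hπ] at hy hz
    by_cases h0 : c 0 = 0 ∧ d 0 = 0
    · refine .inr (.inl ⟨y, (mono h).trans hc hd ?_⟩)
      refine ⟨1, !![z, 1, 0; 1, 0, 0; 0, 0, 1], by simp, by simp [Matrix.det_fin_three],
        by simp [MemC], memC_of π d (by simp [h0.2]) (dvd_zero _) (dvd_zero _), ?_⟩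
      rw [one_mul]
      ext i j
      fin_cases i <;> fin_cases j <;> simp [s2Form, s2s1Form, Matrix.mul_apply, Fin.sum_univ_three]
    obtain ⟨α, β, hα1, hα, hβ1, hβ, h1, h2, hr⟩ := exists_rel_s2Form hπ (under_mem_T hc)
      (under_mem_T hd) (le_max_right _ _) (le_max_right _ _) hy hz h
    simp only [under] at hα hβ h1 h2
    refine .inr (.inr (.inr ⟨.s2, s2_mem_Wcd hc hd hc1 hd1 (by omega), s2Mat π α β,
      ⟨α, β, hα1, ?_, hβ1, ?_, ?_, ?_, rfl⟩, mono hr⟩))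
    all_goals first | omega | (simp only [under]; omega)
  · rw [not_isUnit_iff_dvd hπ] at hy hz hw
    exact .inr (.inr (.inr (hT hy hz hw (mono h))))

/-- The matrices among the distinguished representatives whose double cosets can support
intertwining operators. -/
def IsRep (π : R) (s : GL (Fin 3) R) : Prop :=
  (∃ a ∈ T1, ∃ x : Rˣ, s = tMat π a x) ∨ (∃ α β : ℕ, 1 ≤ α ∧ 1 ≤ β ∧ s = s1Mat π α β) ∨
    ∃ α β : ℕ, 1 ≤ α ∧ 1 ≤ β ∧ s = s2Mat π α β

theorem identified_of_rel (hπ : Irreducible π) (M N : ℕ) {s s' : GL (Fin 3) R} (hs : IsRep π s)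
    (hs' : IsRep π s') : ∃ n, ∀ c d : Triple, (∀ i, n ≤ c i) → (∀ i, n ≤ d i) →
      Rel π c d s.val s'.val → Rel π c d s'.val s.val → Identified π M N s s' := by
  have pos : ∀ {n : ℕ} {c : Triple}, (∀ i, n + 1 ≤ c i) → ∀ i, 1 ≤ c i := fun h i =>
    le_trans (by omega) (h i)
  have dvd : ∀ {m : ℕ}, 1 ≤ m → π ∣ π ^ m := fun h => dvd_pow_self π (by omega)
  rcases hs with ⟨a, ha, x, rfl⟩ | ⟨α, β, hα, hβ, rfl⟩ | ⟨α, β, hα, hβ, rfl⟩ <;>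
    rcases hs' with ⟨b, hb, y, rfl⟩ | ⟨α', β', hα', hβ', rfl⟩ | ⟨α', β', hα', hβ', rfl⟩
  · by_cases hab : a = b
    · subst hab
      obtain ⟨n, hn⟩ := sameXLimit_of_rel hπ ha (x : R) y
      exact ⟨n, fun c d hc hd h _ => .inr ⟨a, ha, x, y, rfl, rfl,
        (sameXLarge_iff hπ M N ha _ _).2 (hn c d hc hd h)⟩⟩
    · exact ⟨a 2 + b 2 + 1, fun c d hc hd h _ => absurd (eq_of_rel_tForm hπ ha hb x.isUnit y.isUnit
        (by omega) (by omega) hc hd h) hab⟩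
  · exact ⟨1, fun c d hc hd _ h => absurd h
      (not_rel_s1Form_tForm hπ hc hd (dvd hβ') (dvd ha.1))⟩
  · exact ⟨1, fun c d hc hd _ h => absurd h (not_rel_s2Form_tForm hπ hc hd
      ((dvd (ha.1.trans ha.2.2.1)).mul_left _) (dvd ha.2.1))⟩
  · exact ⟨1, fun c d hc hd h _ => absurd h
      (not_rel_s1Form_tForm hπ hc hd (dvd hβ) (dvd hb.1))⟩
  · refine ⟨α + β + α' + β' + 1, fun c d hc hd h _ => ?_⟩
    obtain ⟨rfl, rfl⟩ := eq_of_rel_s1Form hπ (by omega) (by omega) (by omega) (by omega) hβ' hc hd h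
    exact .inl rfl
  · exact ⟨1, fun c d hc hd h _ => absurd h
      (not_rel_s1Form_s2Form hπ hc hd (dvd hβ) (dvd hβ'))⟩
  · exact ⟨1, fun c d hc hd h _ => absurd h (not_rel_s2Form_tForm hπ hc hd
      ((dvd (hb.1.trans hb.2.2.1)).mul_left _) (dvd hb.2.1))⟩
  · exact ⟨1, fun c d hc hd _ h => absurd h
      (not_rel_s1Form_s2Form hπ hc hd (dvd hβ') (dvd hβ))⟩
  · refine ⟨α + β + α' + β' + 1, fun c d hc hd h _ => ?_⟩
    obtain ⟨rfl, rfl⟩ := eq_of_rel_s2Form hπ (by omega) (by omega) (by omega) (by omega) hα hc hd h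
    exact .inl rfl

theorem rel_of_identified (hπ : Irreducible π) {M N : ℕ} {s s' : GL (Fin 3) R}
    (h : Identified π M N s s') (c d : Triple) : Rel π c d s.val s'.val := by
  rcases h with rfl | ⟨a, ha, x, y, rfl, rfl, h⟩
  · exact Rel.refl π c d _
  · exact rel_of_sameXLimit hπ ha x y ((sameXLarge_iff hπ M N ha _ _).1 h) c d

/-- The representatives `t_{a,x}` in the theorem support operators of some `U_c`, for all large
`c = (n, n, n)`. -/
theorem exists_matSupports_tMat (hπ : Irreducible π) {M N : ℕ} (hMN : M ≤ N) {e₂ e₃ : R → ℂ}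
    (he : CharPair π M N e₂ e₃) {a : Triple} (ha : a ∈ T1) (x : Rˣ) (hmax : N ≤ max (a 0) (a 1))
    (hx : ¬ (a 0 + a 1 = a 2 ∧ x = 1 ∧ (a 0 < M ∨ a 1 < N))) :
    ∃ n₀, ∀ n, n₀ ≤ n → MatSupports π e₂ e₃ (fun _ => n) (fun _ => n) (tMat π a (x : R)).val := by
  by_cases hD : (x : R) * π ^ a 2 - π ^ a 0 * π ^ a 1 = 0
  · have hD' : (x : R) * π ^ a 2 = (1 : Rˣ) * π ^ (a 0 + a 1) := by
      rw [Units.val_one, pow_add]; linear_combination hD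
    have hsum : a 0 + a 1 = a 2 := by
      refine le_antisymm ?_ ?_
      · rw [← pow_dvd_unit_mul_pow_iff hπ x, hD']; exact dvd_mul_left _ _
      · rw [← pow_dvd_unit_mul_pow_iff hπ 1, ← hD']; exact dvd_mul_left _ _
    obtain rfl : x = 1 := by
      rw [hsum] at hD'
      exact Units.ext (mul_right_cancel₀ (pow_ne_zero _ hπ.ne_zero) hD')
    refine ⟨0, fun n _ => ?_⟩
    have := matSupports_tForm_one (c := fun _ => n) (d := fun _ => n) he hMN hsum
      (by by_contra; exact hx ⟨hsum, rfl, by omega⟩) (by by_contra; exact hx ⟨hsum, rfl, by omega⟩)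
    convert this using 1
    simp [tMat, tForm]
  · obtain ⟨δ, u, hu⟩ := IsDiscreteValuationRing.eq_unit_mul_pow_irreducible hD hπ
    exact ⟨a 2 + δ + N, fun n hn => matSupports_tForm he hπ hMN ha x u hu hmax hn
      (fun _ => le_rfl) (fun _ => le_rfl)⟩

end Representatives

/-! ### Inverses of the elements of `C_c` -/

section Group

variable {R : Type*} [CommRing R] {π : R}

theorem MemC.inv {c : Triple} (hc : c ∈ T) {g : GL (Fin 3) R} (hg : MemC π c g.val) :
    MemC π c (g⁻¹).val := by
  obtain ⟨h02, h12, h2⟩ := hc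
  obtain ⟨g1, g2, g3⟩ := hg
  have key : g.val.adjugate = g.val.det • (g⁻¹).val := by
    have h : g.val * (g⁻¹).val = 1 := g.mul_inv
    rw [← mul_one g.val.adjugate, ← h, ← mul_assoc, Matrix.adjugate_mul, Matrix.smul_mul, one_mul]
  obtain ⟨u, hu⟩ : IsUnit g.val.det := (Matrix.isUnit_iff_isUnit_det _).1 g.isUnit
  rw [Matrix.adjugate_fin_three, ← hu] at key
  have k1 := congrFun (congrFun key 1) 0
  have k2 := congrFun (congrFun key 2) 1
  have k3 := congrFun (congrFun key 2) 0
  simp only [Matrix.of_apply, Matrix.cons_val', Matrix.cons_val_zero, Matrix.cons_val_one,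
    Matrix.cons_val, Matrix.smul_apply, smul_eq_mul] at k1 k2 k3
  refine ⟨?_, ?_, ?_⟩
  · rw [← Units.dvd_mul_left (u := u), ← k1]
    exact dvd_add ((dvd_neg).2 (g1.mul_right _)) (((pow_dvd_pow π h02).trans g3).mul_left _)
  · rw [← Units.dvd_mul_left (u := u), ← k2]
    exact dvd_add ((dvd_neg).2 (g2.mul_left _)) (((pow_dvd_pow π h12).trans g3).mul_left _)
  · rw [← Units.dvd_mul_left (u := u), ← k3]
    refine dvd_sub ((pow_dvd_pow π h2).trans ?_) (g3.mul_left _)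
    rw [pow_add]
    exact mul_dvd_mul g1 g2

end Group

section LocalField

/-! ### Characters on the units of the ring of integers -/

variable {F : Type*} [Field F] [ValuativeRel F] {χ χ₂ χ₃ : Fˣ →* ℂˣ}

theorem extChar_unit (χ : Fˣ →* ℂˣ) (u : 𝒪[F]ˣ) : extChar χ u = unitChar χ u := by
  rw [extChar, dif_pos u.isUnit]
  congr 2
  exact Units.ext rfl

theorem extChar_ne_zero (χ : Fˣ →* ℂˣ) (r : 𝒪[F]) : extChar χ r ≠ 0 := by
  unfold extChar
  split_ifs <;> simp

theorem extChar_one (χ : Fˣ →* ℂˣ) : extChar χ (1 : 𝒪[F]) = 1 := by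
  have := extChar_unit χ (1 : 𝒪[F]ˣ)
  simpa using this

theorem IsConductor.extChar_eq_one (h : IsConductor χ 0) (r : 𝒪[F]) : extChar χ r = 1 := by
  by_cases hr : IsUnit r
  · obtain ⟨u, rfl⟩ := hr
    rw [extChar_unit, h.1 u (by simp)]
    simp
  · rw [extChar, dif_neg hr]

theorem extChar_mul (χ : Fˣ →* ℂˣ) {r s : 𝒪[F]} (hr : IsUnit r) (hs : IsUnit s) :
    extChar χ (r * s) = extChar χ r * extChar χ s := by
  obtain ⟨u, rfl⟩ := hr
  obtain ⟨v, rfl⟩ := hs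
  rw [← Units.val_mul, extChar_unit, extChar_unit, extChar_unit, map_mul, Units.val_mul]

theorem unitChar_eq_one_iff {u : 𝒪[F]ˣ} : unitChar χ u = 1 ↔ extChar χ u = 1 := by
  rw [extChar_unit, Units.val_eq_one]

theorem chi_ne_zero (g : GL (Fin 3) 𝒪[F]) : chi χ₂ χ₃ g ≠ 0 :=
  mul_ne_zero (extChar_ne_zero _ _) (extChar_ne_zero _ _)

theorem chi_one : chi χ₂ χ₃ (1 : GL (Fin 3) 𝒪[F]) = 1 := by
  simp [chi, extChar_one]

/-! ### The subgroups `C_c` and their double cosets -/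

variable [TopologicalSpace F] [IsNonarchimedeanLocalField F] {π : 𝒪[F]} {M N : ℕ}
  {c d : Triple}

theorem mem_maximalIdeal_pow_iff (hπ : Irreducible π) {r : 𝒪[F]} {n : ℕ} :
    r ∈ 𝓂[F] ^ n ↔ π ^ n ∣ r := by
  rw [hπ.maximalIdeal_eq, Ideal.span_singleton_pow, Ideal.mem_span_singleton]

theorem mem_C_iff (hπ : Irreducible π) {g : GL (Fin 3) 𝒪[F]} : g ∈ C c ↔ MemC π c g.val := by
  simp only [C, Set.mem_ofPred_eq, mem_maximalIdeal_pow_iff hπ, MemC]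

theorem isUnit_two_of_ringChar (hp : 2 < ringChar 𝓀[F]) : IsUnit (2 : 𝒪[F]) := by
  by_contra h
  rw [← mem_nonunits_iff, ← IsLocalRing.mem_maximalIdeal, ← IsLocalRing.residue_eq_zero_iff,
    map_ofNat] at h
  have := Nat.le_of_dvd two_pos (ringChar.dvd (R := 𝓀[F]) (x := 2) (by exact_mod_cast h))
  omega

/-- The subgroup `C_c` of `GL(3, 𝒪)`. -/
def subgroupC (F : Type*) [Field F] [ValuativeRel F] [TopologicalSpace F]
    [IsNonarchimedeanLocalField F] {c : Triple} (hc : c ∈ T) : Subgroup (GL (Fin 3) 𝒪[F]) where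
  carrier := C c
  mul_mem' {g h} hg hh := by
    obtain ⟨π, hπ⟩ := IsDiscreteValuationRing.exists_irreducible 𝒪[F]
    rw [mem_C_iff hπ] at *
    exact hg.mul hc hh
  one_mem' := by
    obtain ⟨π, hπ⟩ := IsDiscreteValuationRing.exists_irreducible 𝒪[F]
    rw [mem_C_iff hπ]
    simp [MemC]
  inv_mem' {g} hg := by
    obtain ⟨π, hπ⟩ := IsDiscreteValuationRing.exists_irreducible 𝒪[F]
    rw [mem_C_iff hπ] at *
    exact hg.inv hc

theorem rel_iff (hπ : Irreducible π) {A B : GL (Fin 3) 𝒪[F]} :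
    Rel π c d A.val B.val ↔ ∃ g ∈ C c, ∃ h ∈ C d, g * A = B * h := by
  constructor
  · rintro ⟨G, H, hG, hH, h1, h2, h⟩
    obtain ⟨g, rfl⟩ := (Matrix.isUnit_iff_isUnit_det _).2 hG
    obtain ⟨k, rfl⟩ := (Matrix.isUnit_iff_isUnit_det _).2 hH
    exact ⟨g, (mem_C_iff hπ).2 h1, k, (mem_C_iff hπ).2 h2, Units.ext h⟩
  · rintro ⟨g, hg, k, hk, h⟩
    exact ⟨g.val, k.val, (Matrix.isUnit_iff_isUnit_det _).1 g.isUnit,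
      (Matrix.isUnit_iff_isUnit_det _).1 k.isUnit, (mem_C_iff hπ).1 hg, (mem_C_iff hπ).1 hk,
      congrArg Units.val h⟩

theorem rel_iff_mem_dcoset (hπ : Irreducible π) (hc : c ∈ T) {A B : GL (Fin 3) 𝒪[F]} :
    Rel π c d A.val B.val ↔ A ∈ dcoset c d B := by
  rw [rel_iff hπ, dcoset, DoubleCoset.mem_doubleCoset]
  constructor
  · rintro ⟨g, hg, k, hk, h⟩
    exact ⟨g⁻¹, (subgroupC F hc).inv_mem hg, k, hk, by rw [mul_assoc, ← h, inv_mul_cancel_left]⟩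
  · rintro ⟨g, hg, k, hk, h⟩
    exact ⟨g⁻¹, (subgroupC F hc).inv_mem hg, k, hk, by rw [h]; group⟩

theorem dcoset_eq_iff_rel (hπ : Irreducible π) (hc : c ∈ T) (hd : d ∈ T)
    {A B : GL (Fin 3) 𝒪[F]} : dcoset c d A = dcoset c d B ↔ Rel π c d A.val B.val := by
  rw [rel_iff_mem_dcoset hπ hc]
  constructor
  · intro h
    rw [← h]
    exact DoubleCoset.mem_doubleCoset_self (subgroupC F hc) (subgroupC F hd) A
  · exact DoubleCoset.doubleCoset_eq_of_mem (H := subgroupC F hc) (K := subgroupC F hd)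

/-! ### The characters of the groups `C_c` and the support condition -/

theorem IsConductor.extChar_congr (hπ : Irreducible π) {m : ℕ} (h : IsConductor χ m)
    {r s : 𝒪[F]} (hrs : π ^ m ∣ r - s) : extChar χ r = extChar χ s := by
  rcases Nat.eq_zero_or_pos m with rfl | hm
  · rw [h.extChar_eq_one, h.extChar_eq_one]
  have hdvd : π ∣ r - s := (dvd_pow_self π hm.ne').trans hrs
  by_cases hr : IsUnit r
  · obtain ⟨v, rfl⟩ : IsUnit s := by
      have := isUnit_add_of_dvd hπ hr ((dvd_neg).2 hdvd)
      rwa [neg_sub, add_sub_cancel] at this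
    obtain ⟨u, rfl⟩ := hr
    have h1 : unitChar χ (u * v⁻¹) = 1 := by
      refine h.1 _ ((mem_maximalIdeal_pow_iff hπ).2 ?_)
      rw [Units.val_mul, ← Units.dvd_mul_right (u := v), sub_mul, Units.inv_mul_cancel_right,
        one_mul]
      exact hrs
    rw [map_mul, map_inv, mul_inv_eq_one] at h1
    rw [extChar_unit, extChar_unit, h1]
  · have hs : ¬ IsUnit s := by
      rw [not_isUnit_iff_dvd hπ] at hr ⊢
      exact (dvd_sub_right hr).1 hdvd
    rw [extChar, dif_neg hr, extChar, dif_neg hs]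

theorem charPair_extChar (hπ : Irreducible π) (hN : 0 < N) (h₂ : IsConductor χ₂ M)
    (h₃ : IsConductor χ₃ N) (h₂₃ : IsConductor (χ₂ / χ₃) N) :
    CharPair π M N (extChar χ₂ : 𝒪[F] → ℂ) (extChar χ₃) where
  one₂ := extChar_one χ₂
  one₃ := extChar_one χ₃
  ne_zero₂ := extChar_ne_zero χ₂
  congr₂ _ _ := h₂.extChar_congr hπ
  congr₃ _ _ := h₃.extChar_congr hπ
  nontrivial₃ := by
    by_contra! h
    have : N ≤ 0 := h₃.2 fun u _ => unitChar_eq_one_iff.2 (h u)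
    omega
  le₂ n _ h := h₂.2 fun u hu => by
    obtain ⟨v, hv⟩ := (mem_maximalIdeal_pow_iff hπ).1 hu
    rw [unitChar_eq_one_iff, eq_add_of_sub_eq' hv, h]
  le₃ n _ h := h₃.2 fun u hu => by
    obtain ⟨v, hv⟩ := (mem_maximalIdeal_pow_iff hπ).1 hu
    rw [unitChar_eq_one_iff, eq_add_of_sub_eq' hv, h]
  le₂₃ n _ h := h₂₃.2 fun u hu => by
    obtain ⟨v, hv⟩ := (mem_maximalIdeal_pow_iff hπ).1 hu
    have := h v
    rw [← eq_add_of_sub_eq' hv, extChar_unit, extChar_unit, Units.val_inj] at this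
    change unitChar χ₂ u / unitChar χ₃ u = 1
    rw [this, div_self']

/-- The function `χ_c` is multiplicative on `C_c`. -/
theorem chi_mul (hMN : M ≤ N) (hN : 0 < N) (h₂ : IsConductor χ₂ M) (h₃ : IsConductor χ₃ N)
    (hc : c ∈ Tm M N) {g h : GL (Fin 3) 𝒪[F]} (hg : g ∈ C c) (hh : h ∈ C c) :
    chi χ₂ χ₃ (g * h) = chi χ₂ χ₃ g * chi χ₂ χ₃ h := by
  obtain ⟨π, hπ⟩ := IsDiscreteValuationRing.exists_irreducible 𝒪[F]
  rw [mem_C_iff hπ] at hg hh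
  have hM0 : M ≤ c 0 := hc.2 0
  have hN1 : N ≤ c 1 := hc.2 1
  have hN2 : N ≤ c 2 := hc.2 2
  have hu : ∀ {g : GL (Fin 3) 𝒪[F]}, IsUnit g.val.det := fun {g} =>
    (Matrix.isUnit_iff_isUnit_det _).1 g.isUnit
  have diag : ∀ {g : GL (Fin 3) 𝒪[F]}, MemC π c g.val → IsUnit (g.val 2 2) := by
    intro g hg
    obtain ⟨-, g2, g3⟩ := hg
    by_contra hn
    rw [not_isUnit_iff_dvd hπ] at hn
    refine (not_isUnit_iff_dvd hπ).2 ?_ (hu (g := g))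
    have g2' : π ∣ g.val 2 1 := (dvd_pow_self π (by omega)).trans g2
    have g3' : π ∣ g.val 2 0 := (dvd_pow_self π (by omega)).trans g3
    rw [Matrix.det_fin_three]
    exact dvd_sub (dvd_add (dvd_add (dvd_sub (dvd_sub (hn.mul_left _) (g2'.mul_left _))
      (hn.mul_left _)) (g3'.mul_left _)) (g2'.mul_left _)) (g3'.mul_left _)
  have e₂ : extChar χ₂ ((g * h).val 1 1) = extChar χ₂ (g.val 1 1) * extChar χ₂ (h.val 1 1) := by
    rcases Nat.eq_zero_or_pos M with rfl | hM
    · simp only [h₂.extChar_eq_one, mul_one]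
    have hc1 : ∀ i, 1 ≤ c i := by intro i; fin_cases i <;> simp <;> omega
    rw [← extChar_mul χ₂ (hg.isUnit_diag hπ hc1 hu).2.1 (hh.isUnit_diag hπ hc1 hu).2.1]
    refine h₂.extChar_congr hπ ?_
    rw [Units.val_mul, Matrix.mul_apply, Fin.sum_univ_three]
    rw [show ∀ a b e : 𝒪[F], a + b + e - b = a + e from fun a b e => by ring]
    exact dvd_add (((pow_dvd_pow π hM0).trans hg.1).mul_right _)
      (((pow_dvd_pow π (hMN.trans hN1)).trans hh.2.1).mul_left _)
  have e₃ : extChar χ₃ ((g * h).val 2 2) = extChar χ₃ (g.val 2 2) * extChar χ₃ (h.val 2 2) := by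
    rw [← extChar_mul χ₃ (diag hg) (diag hh)]
    refine h₃.extChar_congr hπ ?_
    rw [Units.val_mul, Matrix.mul_apply, Fin.sum_univ_three, add_sub_cancel_right]
    exact dvd_add (((pow_dvd_pow π hN2).trans hg.2.2).mul_right _)
      (((pow_dvd_pow π hN1).trans hg.2.1).mul_right _)
  rw [chi, e₂, e₃, chi, chi]
  ring

/-- A double coset supports an intertwining operator if and only if the characters agree on the
stabiliser of the representative; the operator is then determined by its value there. -/
theorem supports_iff (hπ : Irreducible π) (hMN : M ≤ N) (hN : 0 < N) (h₂ : IsConductor χ₂ M)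
    (h₃ : IsConductor χ₃ N) (hc : c ∈ Tm M N) (hd : d ∈ Tm M N) (k : GL (Fin 3) 𝒪[F]) :
    Supports χ₂ χ₃ c d k ↔ MatSupports π (extChar χ₂) (extChar χ₃) c d k.val := by
  constructor
  · rintro ⟨f, hf, hk⟩ G H hG hH hGc hHd h
    obtain ⟨g, rfl⟩ := (Matrix.isUnit_iff_isUnit_det _).2 hG
    obtain ⟨g', rfl⟩ := (Matrix.isUnit_iff_isUnit_det _).2 hH
    have h1 := hf g ((mem_C_iff hπ).2 hGc) 1 (subgroupC F hd.1).one_mem k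
    have h2 := hf 1 (subgroupC F hc.1).one_mem g' ((mem_C_iff hπ).2 hHd) k
    rw [chi_one, mul_one, mul_one] at h1
    rw [chi_one, one_mul, one_mul, show k * g' = g * k from Units.ext h.symm, h1, mul_comm] at h2
    exact mul_left_cancel₀ hk h2
  · intro h
    have hstab : ∀ g ∈ C c, ∀ g' ∈ C d, g * k = k * g' → chi χ₂ χ₃ g = chi χ₂ χ₃ g' := by
      intro g hg g' hg' hk
      exact h g.val g'.val ((Matrix.isUnit_iff_isUnit_det _).1 g.isUnit)
        ((Matrix.isUnit_iff_isUnit_det _).1 g'.isUnit) ((mem_C_iff hπ).1 hg)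
        ((mem_C_iff hπ).1 hg') (congrArg Units.val hk)
    have hwd : ∀ g₁ ∈ C c, ∀ g₂ ∈ C c, ∀ h₁ ∈ C d, ∀ h₂ ∈ C d, g₁ * k * h₁ = g₂ * k * h₂ →
        chi χ₂ χ₃ g₁ * chi χ₂ χ₃ h₁ = chi χ₂ χ₃ g₂ * chi χ₂ χ₃ h₂ := by
      intro g₁ hg₁ g₂ hg₂ k₁ hk₁ k₂ hk₂ he
      have m1 : g₂⁻¹ * g₁ ∈ C c :=
        (subgroupC F hc.1).mul_mem ((subgroupC F hc.1).inv_mem hg₂) hg₁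
      have m2 : k₂ * k₁⁻¹ ∈ C d :=
        (subgroupC F hd.1).mul_mem hk₂ ((subgroupC F hd.1).inv_mem hk₁)
      have h1 := hstab _ m1 _ m2 (by
        rw [mul_assoc, inv_mul_eq_iff_eq_mul, ← mul_assoc, ← mul_assoc, eq_mul_inv_iff_mul_eq, he])
      have h3 := chi_mul hMN hN h₂ h₃ hc hg₂ m1
      have h4 := chi_mul hMN hN h₂ h₃ hd m2 hk₁
      rw [mul_inv_cancel_left] at h3
      rw [inv_mul_cancel_right] at h4
      rw [h3, h4, h1]
      ring
    classical
    let f : GL (Fin 3) 𝒪[F] → ℂ := fun x =>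
      if hx : ∃ p : GL (Fin 3) 𝒪[F] × GL (Fin 3) 𝒪[F], p.1 ∈ C c ∧ p.2 ∈ C d ∧
        x = p.1 * k * p.2 then chi χ₂ χ₃ hx.choose.1 * chi χ₂ χ₃ hx.choose.2 else 0
    have hf : ∀ g ∈ C c, ∀ g' ∈ C d, f (g * k * g') = chi χ₂ χ₃ g * chi χ₂ χ₃ g' := by
      intro g hg g' hg'
      have hx : ∃ p : GL (Fin 3) 𝒪[F] × GL (Fin 3) 𝒪[F], p.1 ∈ C c ∧ p.2 ∈ C d ∧
        g * k * g' = p.1 * k * p.2 := ⟨(g, g'), hg, hg', rfl⟩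
      simp only [f]
      rw [dif_pos hx]
      obtain ⟨m1, m2, m3⟩ := hx.choose_spec
      exact hwd _ m1 _ hg _ m2 _ hg' m3.symm
    refine ⟨f, fun g hg g' hg' x => ?_, ?_⟩
    · by_cases hx : ∃ p : GL (Fin 3) 𝒪[F] × GL (Fin 3) 𝒪[F], p.1 ∈ C c ∧ p.2 ∈ C d ∧
        x = p.1 * k * p.2
      · obtain ⟨⟨p, q⟩, hp, hq, rfl⟩ := hx
        rw [hf p hp q hq, show g * (p * k * q) * g' = (g * p) * k * (q * g') by group,
          hf _ ((subgroupC F hc.1).mul_mem hg hp) _ ((subgroupC F hd.1).mul_mem hq hg'),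
          chi_mul hMN hN h₂ h₃ hc hg hp, chi_mul hMN hN h₂ h₃ hd hq hg']
        ring
      · have hx' : ¬ ∃ p : GL (Fin 3) 𝒪[F] × GL (Fin 3) 𝒪[F], p.1 ∈ C c ∧ p.2 ∈ C d ∧
            g * x * g' = p.1 * k * p.2 := by
          rintro ⟨⟨p, q⟩, hp, hq, he⟩
          refine hx ⟨(g⁻¹ * p, q * g'⁻¹),
            (subgroupC F hc.1).mul_mem ((subgroupC F hc.1).inv_mem hg) hp,
            (subgroupC F hd.1).mul_mem hq ((subgroupC F hd.1).inv_mem hg'), ?_⟩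
          have : x = g⁻¹ * (g * x * g') * g'⁻¹ := by group
          rw [this, he]
          group
        simp only [f]
        rw [dif_neg hx, dif_neg hx']
        ring
    · have := hf 1 (subgroupC F hc.1).one_mem 1 (subgroupC F hd.1).one_mem
      rw [one_mul, mul_one, chi_one, mul_one] at this
      rw [this]
      exact one_ne_zero

theorem Supports.of_mem_dcoset {k k' : GL (Fin 3) 𝒪[F]} (h : Supports χ₂ χ₃ c d k)
    (hk : k' ∈ dcoset c d k) : Supports χ₂ χ₃ c d k' := by
  obtain ⟨f, hf, hfk⟩ := h
  obtain ⟨g, hg, g', hg', rfl⟩ := DoubleCoset.mem_doubleCoset.1 hk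
  refine ⟨f, hf, ?_⟩
  rw [hf g hg g' hg']
  exact mul_ne_zero (mul_ne_zero (chi_ne_zero g) hfk) (chi_ne_zero g')

theorem Supports.matSupports_of_rel (hπ : Irreducible π) (hMN : M ≤ N) (hN : 0 < N)
    (h₂ : IsConductor χ₂ M) (h₃ : IsConductor χ₃ N) (hc : c ∈ Tm M N) (hd : d ∈ Tm M N)
    {k : GL (Fin 3) 𝒪[F]} (h : Supports χ₂ χ₃ c d k) {B : Matrix (Fin 3) (Fin 3) 𝒪[F]}
    (hr : Rel π c d k.val B) : MatSupports π (extChar χ₂) (extChar χ₃) c d B := by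
  obtain ⟨b, rfl⟩ := (Matrix.isUnit_iff_isUnit_det _).2
    (hr.isUnit_det ((Matrix.isUnit_iff_isUnit_det _).1 k.isUnit))
  rw [← supports_iff hπ hMN hN h₂ h₃ hc hd]
  refine h.of_mem_dcoset ?_
  rw [(dcoset_eq_iff_rel hπ hc.1 hd.1).2 hr]
  exact DoubleCoset.mem_doubleCoset_self (subgroupC F hc.1) (subgroupC F hd.1) b

/-! ### The sets `S^w` -/

theorem exists_s1Mat_mem_Scd (hπ : Irreducible π) (hMN : M ≤ N) (hN : 0 < N) (h₂ : IsConductor χ₂ M)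
    (h₃ : IsConductor χ₃ N) (he : CharPair π M N (extChar χ₂ : 𝒪[F] → ℂ) (extChar χ₃))
    {k : GL (Fin 3) 𝒪[F]} {α β : ℕ} (hα : N ≤ α) (hβ : N ≤ β) (hk : k = s1Mat π α β) :
    ∃ c ∈ Tm M N, k ∈ Scd π χ₂ χ₃ c c .s1 := by
  have hT : (fun _ => α + β + N) ∈ Tm M N := const_mem_Tm (by omega) (by omega)
  refine ⟨_, hT, mem_Wcd_of_pos hT.1 hT.1 (by omega) (by omega) (by omega) (by omega) _,
    ⟨α, β, by omega, ?_, by omega, ?_, by push_cast; omega, by push_cast; omega, hk⟩, ?_⟩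
  · simp only [under]; omega
  · simp only [under]; omega
  · rw [supports_iff hπ hMN hN h₂ h₃ hT hT, hk]
    exact matSupports_s1Form he hπ hMN hα hβ le_rfl (fun _ => le_rfl) (fun _ => le_rfl)

theorem exists_s2Mat_mem_Scd (hπ : Irreducible π) (hMN : M ≤ N) (hN : 0 < N) (h₂ : IsConductor χ₂ M)
    (h₃ : IsConductor χ₃ N) (he : CharPair π M N (extChar χ₂ : 𝒪[F] → ℂ) (extChar χ₃))
    {k : GL (Fin 3) 𝒪[F]} {α β : ℕ} (hα : N ≤ α) (hβ : N ≤ β) (hk : k = s2Mat π α β) :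
    ∃ c ∈ Tm M N, k ∈ Scd π χ₂ χ₃ c c .s2 := by
  have hT : (fun _ => α + β + N) ∈ Tm M N := const_mem_Tm (by omega) (by omega)
  refine ⟨_, hT, mem_Wcd_of_pos hT.1 hT.1 (by omega) (by omega) (by omega) (by omega) _,
    ⟨α, β, by omega, ?_, by omega, ?_, by push_cast; omega, by push_cast; omega, hk⟩, ?_⟩
  · simp only [under]; omega
  · simp only [under]; omega
  · rw [supports_iff hπ hMN hN h₂ h₃ hT hT, hk]
    exact matSupports_s2Form he hπ hMN hα hβ le_rfl (fun _ => le_rfl) (fun _ => le_rfl)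

theorem exists_tMat_mem_Scd (hπ : Irreducible π) (hMN : M ≤ N) (hN : 0 < N) (h₂ : IsConductor χ₂ M)
    (h₃ : IsConductor χ₃ N) (he : CharPair π M N (extChar χ₂ : 𝒪[F] → ℂ) (extChar χ₃))
    {k : GL (Fin 3) 𝒪[F]} {a : Triple} (ha : a ∈ T1) (hmax : N ≤ max (a 0) (a 1)) {x : 𝒪[F]ˣ}
    (hx : ¬ (a 0 + a 1 = a 2 ∧ x = 1 ∧ (a 0 < M ∨ a 1 < N))) (hk : k = tMat π a x) :
    ∃ c ∈ Tm M N, k ∈ Scd π χ₂ χ₃ c c .one := by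
  obtain ⟨n₀, hn₀⟩ := exists_matSupports_tMat hπ hMN he ha x hmax hx
  obtain ⟨h1, h2, h02, h12⟩ := id ha
  have hT : (fun _ => n₀ + a 2 + N) ∈ Tm M N := const_mem_Tm (by omega) (by omega)
  refine ⟨_, hT, one_mem_Wcd _ _, ⟨a, ?_, x, hk⟩, ?_⟩
  · have hne : (fun _ => n₀ + a 2 + N : Triple) ≠ 0 := fun h => by
      have := congrFun h 0
      simp at this
      omega
    simp only [Tcd, Set.mem_ofPred_eq]
    rw [if_neg (by tauto), if_neg (by omega), if_neg (by omega)]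
    refine ⟨ha, ?_, ?_, ?_⟩
    · intro i; fin_cases i <;> simp [under] <;> omega
    · intro i; fin_cases i <;> simp [under] <;> omega
    · simp only [under]; omega
  · rw [supports_iff hπ hMN hN h₂ h₃ hT hT, hk]
    exact hn₀ _ (by omega)

end LocalField

end PSeries

open PSeries
theorem theoremT {F : Type*} [Field F] [ValuativeRel F] [TopologicalSpace F]
    [IsNonarchimedeanLocalField F] [CharZero F]
    (hp : 2 < ringChar 𝓀[F]) (hq : 3 < Nat.card 𝓀[F])
    (π : 𝒪[F]) (hπ : Irreducible π)
    (χ₂ χ₃ : Fˣ →* ℂˣ) (hχ₂ : Continuous χ₂) (hχ₃ : Continuous χ₃)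
    (M N : ℕ) (hMN : M ≤ N) (hN : 0 < N)
    (hcond₂ : IsConductor χ₂ M) (hcond₃ : IsConductor χ₃ N)
    (hcond₂₃ : IsConductor (χ₂ / χ₃) N) :
    -- the double cosets that support intertwining operators are represented by the `S_{c,d}`
    (∀ c ∈ Tm M N, ∀ d ∈ Tm M N, ∀ k : GL (Fin 3) 𝒪[F],
      Supports χ₂ χ₃ c d k ↔ ∃ w : Weyl, ∃ s ∈ Scd π χ₂ χ₃ c d w, k ∈ dcoset c d s) ∧
    -- every element of the union `S` supports a self-intertwining operator of some `U_c`
    (∀ w : Weyl, ∀ s ∈ SW π χ₂ χ₃ M N w, ∃ c ∈ Tm M N, s ∈ Scd π χ₂ χ₃ c c w) ∧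
    -- the six parts of the union `S`
    SW π χ₂ χ₃ M N .one =
      {k | ∃ a ∈ T1, N ≤ max (a 0) (a 1) ∧ ∃ x : 𝒪[F]ˣ,
        ¬ (a 0 + a 1 = a 2 ∧ x = 1 ∧ (a 0 < M ∨ a 1 < N)) ∧ k = tMat π a x} ∧
    SW π χ₂ χ₃ M N .s1 = {k | ∃ α β : ℕ, N ≤ α ∧ N ≤ β ∧ k = s1Mat π α β} ∧
    SW π χ₂ χ₃ M N .s2 = {k | ∃ α β : ℕ, N ≤ α ∧ N ≤ β ∧ k = s2Mat π α β} ∧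
    SW π χ₂ χ₃ M N .s1s2 = ∅ ∧
    SW π χ₂ χ₃ M N .s2s1 = ∅ ∧
    SW π χ₂ χ₃ M N .w0 = ∅ ∧
    -- up to the identification of parameters, the double cosets are distinct for large `c, d`
    (∀ w w' : Weyl, ∀ s ∈ SW π χ₂ χ₃ M N w, ∀ s' ∈ SW π χ₂ χ₃ M N w',
      ∃ e ∈ Tm M N, ∀ c ∈ Tm M N, ∀ d ∈ Tm M N, e ≤ c → e ≤ d →
        (dcoset c d s = dcoset c d s' ↔ Identified π M N s s')) := by
  have he := charPair_extChar hπ hN hcond₂ hcond₃ hcond₂₃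
  have hmat : ∀ {c d k}, c ∈ Tm M N → d ∈ Tm M N → Supports χ₂ χ₃ c d k →
      MatSupports π (extChar χ₂) (extChar χ₃) c d k.val := fun hc hd h =>
    (supports_iff hπ hMN hN hcond₂ hcond₃ hc hd _).1 h
  have mem_SW : ∀ {w s}, s ∈ SW π χ₂ χ₃ M N w ↔
      ∃ c ∈ Tm M N, ∃ d ∈ Tm M N, s ∈ Scd π χ₂ χ₃ c d w := by
    intro w s
    simp only [SW, Set.mem_iUnion, exists_prop]
  -- What the support condition says about the members of the sets `S^w`.
  have hone : ∀ {s}, s ∈ SW π χ₂ χ₃ M N .one → ∃ a ∈ T1, N ≤ max (a 0) (a 1) ∧ ∃ x : 𝒪[F]ˣ,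
      ¬ (a 0 + a 1 = a 2 ∧ x = 1 ∧ (a 0 < M ∨ a 1 < N)) ∧ s = tMat π a x := by
    intro s hs
    obtain ⟨c, hc, d, hd, -, ⟨a, ha, x, rfl⟩, hs⟩ := mem_SW.1 hs
    have ha := mem_T1_of_mem_Tcd (one_le_of_mem_Tm hN hc).1 (one_le_of_mem_Tm hN hd).1 ha
    refine ⟨a, ha, (hmat hc hd hs).le_max_of_tForm he hπ ha x, x, ?_, rfl⟩
    rintro ⟨hsum, rfl, h⟩
    have hs' := hmat hc hd hs
    have : (tMat π a ((1 : 𝒪[F]ˣ) : 𝒪[F])).val = tForm (π ^ a 0) (π ^ a 2) (π ^ a 1) := by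
      simp [tMat, tForm]
    rw [this] at hs'
    have := hs'.le_of_tForm_one he hπ ha hsum
    omega
  have hs1 : ∀ {s}, s ∈ SW π χ₂ χ₃ M N .s1 → ∃ α β : ℕ, N ≤ α ∧ N ≤ β ∧ s = s1Mat π α β := by
    intro s hs
    obtain ⟨c, hc, d, hd, -, ⟨α, β, hα, -, hβ, -, -, -, rfl⟩, hs⟩ := mem_SW.1 hs
    obtain ⟨h1, h2⟩ := (hmat hc hd hs).le_of_s1Form he hπ hα hβ
    exact ⟨α, β, h1, h2, rfl⟩
  have hs2 : ∀ {s}, s ∈ SW π χ₂ χ₃ M N .s2 → ∃ α β : ℕ, N ≤ α ∧ N ≤ β ∧ s = s2Mat π α β := by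
    intro s hs
    obtain ⟨c, hc, d, hd, -, ⟨α, β, hα, -, hβ, -, -, -, rfl⟩, hs⟩ := mem_SW.1 hs
    obtain ⟨h1, h2⟩ := (hmat hc hd hs).le_of_s2Form he hπ hα hβ
    exact ⟨α, β, h1, h2, rfl⟩
  have hs12 : ∀ {s}, s ∉ SW π χ₂ χ₃ M N .s1s2 := by
    intro s hs
    obtain ⟨c, hc, d, hd, -, ⟨α, -, -, rfl⟩, hs⟩ := mem_SW.1 hs
    exact not_matSupports_s1s2Form he _ (hmat hc hd hs)
  have hs21 : ∀ {s}, s ∉ SW π χ₂ χ₃ M N .s2s1 := by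
    intro s hs
    obtain ⟨c, hc, d, hd, -, ⟨α, -, -, rfl⟩, hs⟩ := mem_SW.1 hs
    exact not_matSupports_s2s1Form he _ (hmat hc hd hs)
  have hw0 : ∀ {s}, s ∉ SW π χ₂ χ₃ M N .w0 := by
    intro s hs
    obtain ⟨c, hc, d, hd, -, rfl, hs⟩ := mem_SW.1 hs
    exact not_matSupports_w0Form he (hmat hc hd hs)
  have hself : ∀ w : Weyl, ∀ s ∈ SW π χ₂ χ₃ M N w, ∃ c ∈ Tm M N, s ∈ Scd π χ₂ χ₃ c c w := by
    intro w s hs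
    cases w with
    | one =>
      obtain ⟨a, ha, hmax, x, hx, hk⟩ := hone hs
      exact exists_tMat_mem_Scd hπ hMN hN hcond₂ hcond₃ he ha hmax hx hk
    | s1 =>
      obtain ⟨α, β, hα, hβ, hk⟩ := hs1 hs
      exact exists_s1Mat_mem_Scd hπ hMN hN hcond₂ hcond₃ he hα hβ hk
    | s2 =>
      obtain ⟨α, β, hα, hβ, hk⟩ := hs2 hs
      exact exists_s2Mat_mem_Scd hπ hMN hN hcond₂ hcond₃ he hα hβ hk
    | s1s2 => exact absurd hs hs12
    | s2s1 => exact absurd hs hs21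
    | w0 => exact absurd hs hw0
  have hrep : ∀ w : Weyl, ∀ s ∈ SW π χ₂ χ₃ M N w, IsRep π s := by
    intro w s hs
    cases w with
    | one =>
      obtain ⟨a, ha, -, x, -, hk⟩ := hone hs
      exact .inl ⟨a, ha, x, hk⟩
    | s1 =>
      obtain ⟨α, β, hα, hβ, hk⟩ := hs1 hs
      exact .inr (.inl ⟨α, β, by omega, by omega, hk⟩)
    | s2 =>
      obtain ⟨α, β, hα, hβ, hk⟩ := hs2 hs
      exact .inr (.inr ⟨α, β, by omega, by omega, hk⟩)
    | s1s2 => exact absurd hs hs12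
    | s2s1 => exact absurd hs hs21
    | w0 => exact absurd hs hw0
  refine ⟨?_, hself, ?_, ?_, ?_, Set.eq_empty_of_forall_notMem fun _ => hs12,
    Set.eq_empty_of_forall_notMem fun _ => hs21, Set.eq_empty_of_forall_notMem fun _ => hw0, ?_⟩
  · intro c hc d hd k
    constructor
    · intro h
      have h2 := isUnit_two_of_ringChar hp
      have hB : ∀ {B}, Rel π c d k.val B → MatSupports π (extChar χ₂) (extChar χ₃) c d B :=
        fun hr => h.matSupports_of_rel hπ hMN hN hcond₂ hcond₃ hc hd hr
      rcases exists_rel_mem_Rcd hπ h2 hc.1 hd.1 (one_le_of_mem_Tm hN hc).1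
        (one_le_of_mem_Tm hN hd).1 ((Matrix.isUnit_iff_isUnit_det _).1 k.isUnit) with
        hr | ⟨_, hr⟩ | ⟨_, hr⟩ | ⟨w, hw, s, hs, hr⟩
      · exact absurd (hB hr) (not_matSupports_w0Form he)
      · exact absurd (hB hr) (not_matSupports_s2s1Form he _)
      · exact absurd (hB hr) (not_matSupports_s1s2Form he _)
      · exact ⟨w, s, ⟨hw, hs, (supports_iff hπ hMN hN hcond₂ hcond₃ hc hd s).2 (hB hr)⟩,
          (rel_iff_mem_dcoset hπ hc.1).1 hr⟩
    · rintro ⟨w, s, hs, hk⟩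
      exact hs.2.2.of_mem_dcoset hk
  · ext k
    refine ⟨hone, ?_⟩
    rintro ⟨a, ha, hmax, x, hx, hk⟩
    obtain ⟨c, hc, hs⟩ := exists_tMat_mem_Scd hπ hMN hN hcond₂ hcond₃ he ha hmax hx hk
    exact mem_SW.2 ⟨c, hc, c, hc, hs⟩
  · ext k
    refine ⟨hs1, ?_⟩
    rintro ⟨α, β, hα, hβ, hk⟩
    obtain ⟨c, hc, hs⟩ := exists_s1Mat_mem_Scd hπ hMN hN hcond₂ hcond₃ he hα hβ hk
    exact mem_SW.2 ⟨c, hc, c, hc, hs⟩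
  · ext k
    refine ⟨hs2, ?_⟩
    rintro ⟨α, β, hα, hβ, hk⟩
    obtain ⟨c, hc, hs⟩ := exists_s2Mat_mem_Scd hπ hMN hN hcond₂ hcond₃ he hα hβ hk
    exact mem_SW.2 ⟨c, hc, c, hc, hs⟩
  · intro w w' s hs s' hs'
    obtain ⟨n, hn⟩ := identified_of_rel hπ M N (hrep w s hs) (hrep w' s' hs')
    refine ⟨fun _ => n + N, const_mem_Tm (by omega) (by omega), fun c hc d hd hec hed => ?_⟩
    constructor
    · intro h
      exact hn c d (fun i => (Nat.le_add_right n N).trans (hec i))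
        (fun i => (Nat.le_add_right n N).trans (hed i))
        ((dcoset_eq_iff_rel hπ hc.1 hd.1).1 h) ((dcoset_eq_iff_rel hπ hc.1 hd.1).1 h.symm)
    · intro h
      exact (dcoset_eq_iff_rel hπ hc.1 hd.1).2 (rel_of_identified hπ h c d)
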